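/- Let $\Bbbk$ be an algebraically closed field, let $A_1,A_2$ be finite dimensional $\Bbbk$-algebras and let $W$ be a finite dimensional $\Bbbk$-central $A_1$-$A_2$-bimodule (i.e. $\lambda w=w\lambda$ for $\lambda\in\Bbbk$, $w\in W$) which is projective as a left $A_1$-module. Let $A=A_1[W]A_2$ be the algebra of triangular matrices $\begin{pmatrix}a_1&w\\0&a_2\end{pmatrix}$ with $a_i\in A_i$, $w\in W$, and let $e_1=\begin{pmatrix}1&0\\0&0\end{pmatrix}$, $e_2=\begin{pmatrix}0&0\\0&1\end{pmatrix}$. Let $P_i$ be a finitely generated projective $A_i$-module $(i=1,2)$, let $\mathbf d=(\mathbf{dim}\,P_1,\mathbf{dim}\,P_2)$, where $\mathbf{dim}$ denotes the vector of Jordan–Hölder multiplicities of the simple modules, and let $n=\dim_\Bbbk P_1+\dim_\Bbbk P_2$. Let $\mathrm{rep}(\mathbf d)$ be the variety of $A$-modules of vector dimension $\mathbf d$, that is, of the $\Bbbk$-algebra homomorphisms $A\to\mathrm{Mat}_n(\Bbbk)$ for which the corresponding module $\Bbbk^n$ has vector dimension $\mathbf d$, with the Zariski topology; the group $\mathrm{GL}_n(\Bbbk)$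 acts on it by conjugation, and its orbits are the isomorphism classes of modules. Let $\mathrm{rep}^{\mathrm p}(P_1,P_2)\subseteq\mathrm{rep}(\mathbf d)$ consist of the modules $M$ with $e_1M\simeq P_1$ as $A_1$-modules and $e_2M\simeq P_2$ as $A_2$-modules, and let $\mathrm{rep}(P_1,P_2)$ be its closure in $\mathrm{rep}(\mathbf d)$. Then for every $M\in\mathrm{rep}^{\mathrm p}(P_1,P_2)$ the codimension of the orbit of $M$ in $\mathrm{rep}(P_1,P_2)$ equals $\dim_\Bbbk\mathrm{Ext}^1_A(M,M)$, i.e. the orbit is contained in $\mathrm{rep}(P_1,P_2)$, the space $\mathrm{Ext}^1_A(M,M)$ is finite dimensional, and $$\dim\mathrm{rep}(P_1,P_2)-\dim(\text{orbit of }M)=\dim_\Bbbk\mathrm{Ext}^1_A(M,M),$$ where the dimensions on the left hand side are the (finite) Krull dimensions of the spaces. In particular, the orbit of $M$ is open in $\mathrm{rep}(P_1,P_2)$ if and only if $\mathrm{Ext}^1_A(M,M)=0$. -/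

import Mathlib

open CategoryTheory

universe u

namespace BimoduleReps

noncomputable section

/-! ## Triangular matrix algebras -/

section Triangular

set_option linter.unusedSectionVars false

/-- The ring `A₁[W]A₂` of triangular matrices with rows `(a₁, w)` and `(0, a₂)`, where
`a₁ ∈ A₁`, `a₂ ∈ A₂` and `w` lies in the `A₁`-`A₂`-bimodule `W`. A right `A₂`-module is a
module over `A₂ᵐᵒᵖ`, so that `w a₂` is written `MulOpposite.op a₂ • w`. -/
@[ext]
structure Triangular (A₁ W A₂ : Type u) : Type u where
  a₁ : A₁
  w : W
  a₂ : A₂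

namespace Triangular

variable {A₁ W A₂ : Type u}

section AddGroup

variable [AddCommGroup A₁] [AddCommGroup W] [AddCommGroup A₂]

instance : Zero (Triangular A₁ W A₂) := ⟨⟨0, 0, 0⟩⟩
instance : Add (Triangular A₁ W A₂) := ⟨fun x y => ⟨x.a₁ + y.a₁, x.w + y.w, x.a₂ + y.a₂⟩⟩
instance : Neg (Triangular A₁ W A₂) := ⟨fun x => ⟨-x.a₁, -x.w, -x.a₂⟩⟩

@[simp] theorem zero_a₁ : (0 : Triangular A₁ W A₂).a₁ = 0 := rfl
@[simp] theorem zero_w : (0 : Triangular A₁ W A₂).w = 0 := rfl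
@[simp] theorem zero_a₂ : (0 : Triangular A₁ W A₂).a₂ = 0 := rfl
@[simp] theorem add_a₁ (x y : Triangular A₁ W A₂) : (x + y).a₁ = x.a₁ + y.a₁ := rfl
@[simp] theorem add_w (x y : Triangular A₁ W A₂) : (x + y).w = x.w + y.w := rfl
@[simp] theorem add_a₂ (x y : Triangular A₁ W A₂) : (x + y).a₂ = x.a₂ + y.a₂ := rfl
@[simp] theorem neg_a₁ (x : Triangular A₁ W A₂) : (-x).a₁ = -x.a₁ := rfl
@[simp] theorem neg_w (x : Triangular A₁ W A₂) : (-x).w = -x.w := rfl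
@[simp] theorem neg_a₂ (x : Triangular A₁ W A₂) : (-x).a₂ = -x.a₂ := rfl

instance : AddCommGroup (Triangular A₁ W A₂) where
  add_assoc x y z := by ext <;> simp [add_assoc]
  zero_add x := by ext <;> simp
  add_zero x := by ext <;> simp
  add_comm x y := by ext <;> simp [add_comm]
  neg_add_cancel x := by ext <;> simp
  nsmul := nsmulRec
  zsmul := zsmulRec

end AddGroup

section Ring

variable [Ring A₁] [Ring A₂] [AddCommGroup W] [Module A₁ W] [Module A₂ᵐᵒᵖ W]

instance : One (Triangular A₁ W A₂) := ⟨⟨1, 0, 1⟩⟩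

/-- Multiplication of triangular matrices. -/
instance : Mul (Triangular A₁ W A₂) :=
  ⟨fun x y => ⟨x.a₁ * y.a₁, x.a₁ • y.w + MulOpposite.op y.a₂ • x.w, x.a₂ * y.a₂⟩⟩

@[simp] theorem one_a₁ : (1 : Triangular A₁ W A₂).a₁ = 1 := rfl
@[simp] theorem one_w : (1 : Triangular A₁ W A₂).w = 0 := rfl
@[simp] theorem one_a₂ : (1 : Triangular A₁ W A₂).a₂ = 1 := rfl
@[simp] theorem mul_a₁ (x y : Triangular A₁ W A₂) : (x * y).a₁ = x.a₁ * y.a₁ := rfl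
@[simp] theorem mul_w (x y : Triangular A₁ W A₂) :
    (x * y).w = x.a₁ • y.w + MulOpposite.op y.a₂ • x.w := rfl
@[simp] theorem mul_a₂ (x y : Triangular A₁ W A₂) : (x * y).a₂ = x.a₂ * y.a₂ := rfl

instance [SMulCommClass A₁ A₂ᵐᵒᵖ W] : Ring (Triangular A₁ W A₂) where
  mul_assoc x y z := by
    ext
    · simp [mul_assoc]
    · simp [mul_smul, add_assoc, smul_comm]
    · simp [mul_assoc]
  one_mul x := by ext <;> simp
  mul_one x := by ext <;> simp
  left_distrib x y z := by
    ext
    · simp [mul_add]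
    · simp only [mul_w, add_w, add_a₂, smul_add, MulOpposite.op_add, add_smul]
      abel
    · simp [mul_add]
  right_distrib x y z := by
    ext
    · simp [add_mul]
    · simp only [mul_w, add_w, add_a₁, smul_add, add_smul]
      abel
    · simp [add_mul]
  zero_mul x := by ext <;> simp
  mul_zero x := by ext <;> simp
  __ := (inferInstance : AddCommGroup (Triangular A₁ W A₂))

/-- The diagonal matrix with entries `a` and `0`. -/
def diag₁ (a : A₁) : Triangular A₁ W A₂ := ⟨a, 0, 0⟩

/-- The diagonal matrix with entries `0` and `a`. -/
def diag₂ (a : A₂) : Triangular A₁ W A₂ := ⟨0, 0, a⟩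

variable [SMulCommClass A₁ A₂ᵐᵒᵖ W]

theorem diag₁_mul (a b : A₁) :
    (diag₁ (a * b) : Triangular A₁ W A₂) = diag₁ a * diag₁ b := by
  ext <;> simp [diag₁]

theorem diag₁_add (a b : A₁) :
    (diag₁ (a + b) : Triangular A₁ W A₂) = diag₁ a + diag₁ b := by
  ext <;> simp [diag₁]

theorem diag₂_mul (a b : A₂) :
    (diag₂ (a * b) : Triangular A₁ W A₂) = diag₂ a * diag₂ b := by
  ext <;> simp [diag₂]

theorem diag₂_add (a b : A₂) :
    (diag₂ (a + b) : Triangular A₁ W A₂) = diag₂ a + diag₂ b := by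
  ext <;> simp [diag₂]

variable (A₁ W A₂)

/-- The projection of `A₁[W]A₂` onto `A₁`. -/
def proj₁ : Triangular A₁ W A₂ →+* A₁ where
  toFun x := x.a₁
  map_one' := rfl
  map_mul' _ _ := rfl
  map_zero' := rfl
  map_add' _ _ := rfl

/-- The projection of `A₁[W]A₂` onto `A₂`. -/
def proj₂ : Triangular A₁ W A₂ →+* A₂ where
  toFun x := x.a₂
  map_one' := rfl
  map_mul' _ _ := rfl
  map_zero' := rfl
  map_add' _ _ := rfl

end Ring

section Algebra

variable {k : Type u} [Field k]

section Module

variable [AddCommGroup A₁] [AddCommGroup W] [AddCommGroup A₂]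
  [Module k A₁] [Module k W] [Module k A₂]

instance : SMul k (Triangular A₁ W A₂) := ⟨fun r x => ⟨r • x.a₁, r • x.w, r • x.a₂⟩⟩

@[simp] theorem smul_a₁ (r : k) (x : Triangular A₁ W A₂) : (r • x).a₁ = r • x.a₁ := rfl
@[simp] theorem smul_w (r : k) (x : Triangular A₁ W A₂) : (r • x).w = r • x.w := rfl
@[simp] theorem smul_a₂ (r : k) (x : Triangular A₁ W A₂) : (r • x).a₂ = r • x.a₂ := rfl

instance : Module k (Triangular A₁ W A₂) where
  one_smul x := by ext <;> simp
  mul_smul r s x := by ext <;> simp [mul_smul]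
  smul_zero r := by ext <;> simp
  smul_add r x y := by ext <;> simp
  add_smul r s x := by ext <;> simp [add_smul]
  zero_smul x := by ext <;> simp

end Module

variable [Ring A₁] [Ring A₂] [AddCommGroup W] [Algebra k A₁] [Algebra k A₂]
  [Module k W] [Module A₁ W] [Module A₂ᵐᵒᵖ W]

instance [SMulCommClass A₁ A₂ᵐᵒᵖ W] [IsScalarTower k A₁ W] [IsScalarTower k A₂ᵐᵒᵖ W] :
    Algebra k (Triangular A₁ W A₂) :=
  Algebra.ofModule
    (fun r x y => by
      ext
      · simp
      · simp [smul_assoc, smul_comm r]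
      · simp)
    (fun r x y => by
      ext
      · simp
      · simp [smul_assoc, smul_comm r]
      · simp)

instance [SMulCommClass A₁ A₂ᵐᵒᵖ W] [IsScalarTower k A₁ W] [IsScalarTower k A₂ᵐᵒᵖ W]
    [Module.Finite k A₁] [Module.Finite k W] [Module.Finite k A₂] :
    Module.Finite k (Triangular A₁ W A₂) :=
  Module.Finite.of_surjective
    ({ toFun := fun p => ⟨p.1, p.2.1, p.2.2⟩
       map_add' := fun _ _ => rfl
       map_smul' := fun _ _ => rfl } : (A₁ × W × A₂) →ₗ[k] Triangular A₁ W A₂)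
    (fun x => ⟨(x.a₁, x.w, x.a₂), rfl⟩)

end Algebra

end Triangular

end Triangular

/-! ## The parts `e₁M` and `e₂M` of a module over `A₁[W]A₂` -/

section Parts

variable (A₁ W A₂ : Type u) [Ring A₁] [Ring A₂] [AddCommGroup W] [Module A₁ W]
  [Module A₂ᵐᵒᵖ W] [SMulCommClass A₁ A₂ᵐᵒᵖ W]
  (M : Type u) [AddCommGroup M] [Module (Triangular A₁ W A₂) M]

/-- The subgroup `e₁M` of `M`, where `e₁` is the diagonal matrix with entries `1` and `0`. -/
def Part₁ : AddSubgroup M :=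
  (DistribSMul.toAddMonoidHom M (Triangular.diag₁ 1 : Triangular A₁ W A₂)).range

/-- The subgroup `e₂M` of `M`, where `e₂` is the diagonal matrix with entries `0` and `1`. -/
def Part₂ : AddSubgroup M :=
  (DistribSMul.toAddMonoidHom M (Triangular.diag₂ 1 : Triangular A₁ W A₂)).range

variable {A₁ W A₂ M}

theorem diag₁_one_smul (m : Part₁ A₁ W A₂ M) :
    (Triangular.diag₁ 1 : Triangular A₁ W A₂) • (m : M) = m := by
  obtain ⟨_, m, rfl⟩ := m
  simp [← mul_smul, ← Triangular.diag₁_mul]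

theorem diag₂_one_smul (m : Part₂ A₁ W A₂ M) :
    (Triangular.diag₂ 1 : Triangular A₁ W A₂) • (m : M) = m := by
  obtain ⟨_, m, rfl⟩ := m
  simp [← mul_smul, ← Triangular.diag₂_mul]

instance : SMul A₁ (Part₁ A₁ W A₂ M) :=
  ⟨fun a m => ⟨(Triangular.diag₁ a : Triangular A₁ W A₂) • (m : M),
    (Triangular.diag₁ a : Triangular A₁ W A₂) • (m : M), by
      simp [← mul_smul, ← Triangular.diag₁_mul]⟩⟩

instance : SMul A₂ (Part₂ A₁ W A₂ M) :=
  ⟨fun a m => ⟨(Triangular.diag₂ a : Triangular A₁ W A₂) • (m : M),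
    (Triangular.diag₂ a : Triangular A₁ W A₂) • (m : M), by
      simp [← mul_smul, ← Triangular.diag₂_mul]⟩⟩

@[simp] theorem part₁_coe_smul (a : A₁) (m : Part₁ A₁ W A₂ M) :
    ((a • m : Part₁ A₁ W A₂ M) : M) = (Triangular.diag₁ a : Triangular A₁ W A₂) • (m : M) := rfl

@[simp] theorem part₂_coe_smul (a : A₂) (m : Part₂ A₁ W A₂ M) :
    ((a • m : Part₂ A₁ W A₂ M) : M) = (Triangular.diag₂ a : Triangular A₁ W A₂) • (m : M) := rfl

/-- `e₁M` is a module over `A₁`, identified with `e₁(A₁[W]A₂)e₁`. -/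
instance : Module A₁ (Part₁ A₁ W A₂ M) where
  one_smul m := Subtype.ext (diag₁_one_smul m)
  mul_smul a b m := Subtype.ext (by simp [Triangular.diag₁_mul, mul_smul])
  smul_zero a := Subtype.ext (by simp)
  smul_add a m m' := Subtype.ext (by simp)
  add_smul a b m := Subtype.ext (by simp [Triangular.diag₁_add, add_smul])
  zero_smul m := Subtype.ext (by
    change (0 : Triangular A₁ W A₂) • (m : M) = 0
    simp)

/-- `e₂M` is a module over `A₂`, identified with `e₂(A₁[W]A₂)e₂`. -/
instance : Module A₂ (Part₂ A₁ W A₂ M) where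
  one_smul m := Subtype.ext (diag₂_one_smul m)
  mul_smul a b m := Subtype.ext (by simp [Triangular.diag₂_mul, mul_smul])
  smul_zero a := Subtype.ext (by simp)
  smul_add a m m' := Subtype.ext (by simp)
  add_smul a b m := Subtype.ext (by simp [Triangular.diag₂_add, add_smul])
  zero_smul m := Subtype.ext (by
    change (0 : Triangular A₁ W A₂) • (m : M) = 0
    simp)

end Parts

/-! ## Dimension vectors -/

section DimVector

/-- The multiplicity `(M : S)` of `S` in a composition series of `M`. By the Jordan–Hölder theorem
all composition series yield the same number, so that the infimum is over a single value
whenever `M` has finite length. -/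
def jhMultiplicity (A : Type u) [Ring A] (M S : Type u) [AddCommGroup M] [Module A M]
    [AddCommGroup S] [Module A S] : ℕ :=
  sInf {m : ℕ | ∃ s : CompositionSeries (Submodule A M), s.head = ⊥ ∧ s.last = ⊤ ∧
    m = Nat.card {i : Fin s.length //
      Nonempty ((s i.succ ⧸ (s i.castSucc).submoduleOf (s i.succ)) ≃ₗ[A] S)}}

/-- A vector dimension: a natural number for every simple module. -/
abbrev DimVector (A : Type u) [Ring A] := {S : ModuleCat.{u} A // IsSimpleModule A S} → ℕ

/-- The vector dimension of `M`, i.e. the multiplicities of the simple modules in `M`. -/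
def dimVector (A : Type u) [Ring A] (M : Type u) [AddCommGroup M] [Module A M] : DimVector A :=
  fun S => jhMultiplicity A M S.1

/-- The vector dimension `(dim P₁, dim P₂)`, where `P₁` and `P₂` are regarded as modules over
`A₁[W]A₂` through the projections onto `A₁` and `A₂`. -/
def dimVectorPair (A₁ W A₂ : Type u) [Ring A₁] [Ring A₂] [AddCommGroup W] [Module A₁ W]
    [Module A₂ᵐᵒᵖ W] [SMulCommClass A₁ A₂ᵐᵒᵖ W]
    (P₁ P₂ : Type u) [AddCommGroup P₁] [Module A₁ P₁] [AddCommGroup P₂] [Module A₂ P₂] :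
    DimVector (Triangular A₁ W A₂) :=
  (letI : Module (Triangular A₁ W A₂) P₁ := Module.compHom P₁ (Triangular.proj₁ A₁ W A₂)
   dimVector (Triangular A₁ W A₂) P₁) +
  (letI : Module (Triangular A₁ W A₂) P₂ := Module.compHom P₂ (Triangular.proj₂ A₁ W A₂)
   dimVector (Triangular A₁ W A₂) P₂)

end DimVector

/-! ## Varieties of modules -/

section Variety

/-- The Zariski topology on the affine space `k^ι`: the closed sets are the zero loci of ideals of
polynomials. -/
@[reducible]
def zariskiTopology (k ι : Type u) [Field k] : TopologicalSpace (ι → k) :=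
  TopologicalSpace.ofClosed
    {Z | ∃ I : Ideal (MvPolynomial ι k), Z = MvPolynomial.zeroLocus k I}
    ⟨⊤, by rw [MvPolynomial.zeroLocus_top]; rfl⟩
    (fun T hT => by
      refine ⟨sSup {I | MvPolynomial.zeroLocus k I ∈ T}, Set.ext fun x => ?_⟩
      have key : ∀ J : Ideal (MvPolynomial ι k),
          x ∈ MvPolynomial.zeroLocus k J ↔ J ≤ RingHom.ker (MvPolynomial.aeval (R := k) x) :=
        fun J => Iff.rfl
      rw [key, sSup_le_iff, Set.mem_sInter]
      constructor
      · intro h I hI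
        exact (key I).1 (h _ hI)
      · intro h Z hZ
        obtain ⟨I, rfl⟩ := hT hZ
        exact (key I).2 (h I hZ))
    (fun Z hZ Z' hZ' => by
      obtain ⟨I, rfl⟩ := hZ
      obtain ⟨J, rfl⟩ := hZ'
      refine ⟨I * J, Set.ext fun x => ?_⟩
      have key : ∀ J : Ideal (MvPolynomial ι k),
          x ∈ MvPolynomial.zeroLocus k J ↔ J ≤ RingHom.ker (MvPolynomial.aeval (R := k) x) :=
        fun J => Iff.rfl
      rw [Set.mem_union, key, key, key]
      exact ((RingHom.ker_isPrime _).mul_le).symm)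

variable (k A : Type u) [Field k] [Ring A] [Algebra k A]

/-- The variety of `A`-module structures on `kⁿ`: its points are the homomorphisms of `k`-algebras
from `A` to the algebra of `n × n` matrices. -/
@[ext]
structure ModuleVariety (n : ℕ) : Type u where
  hom : A →ₐ[k] Matrix (Fin n) (Fin n) k

variable {k A} {n : ℕ}

namespace ModuleVariety

/-- The matrix entries of the elements of a basis of `A`. These coordinates identify the variety of
module structures with a closed subset of an affine space. -/
def coords [Module.Finite k A] (x : ModuleVariety k A n) :
    ULift.{u} (Fin (Module.finrank k A) × Fin n × Fin n) → k :=
  fun i => x.hom (Module.finBasis k A i.down.1) i.down.2.1 i.down.2.2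

/-- The Zariski topology on the variety of modules. -/
instance [Module.Finite k A] : TopologicalSpace (ModuleVariety k A n) :=
  TopologicalSpace.induced coords (zariskiTopology k _)

/-- The `A`-module `kⁿ` which corresponds to a point of the variety. -/
def Carrier (_x : ModuleVariety k A n) : Type u := Fin n → k

variable (x : ModuleVariety k A n)

instance : AddCommGroup x.Carrier := inferInstanceAs (AddCommGroup (Fin n → k))

instance : Module A x.Carrier where
  smul a v := Matrix.mulVec (x.hom a) v
  one_smul v := by
    change Matrix.mulVec (x.hom 1) v = v
    rw [map_one]
    exact Matrix.one_mulVec v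
  mul_smul a b v := by
    change Matrix.mulVec (x.hom (a * b)) v = Matrix.mulVec (x.hom a) (Matrix.mulVec (x.hom b) v)
    rw [map_mul]
    exact (Matrix.mulVec_mulVec _ _ _).symm
  smul_zero a := Matrix.mulVec_zero _
  smul_add a v v' := Matrix.mulVec_add _ _ _
  add_smul a b v := by
    change Matrix.mulVec (x.hom (a + b)) v = Matrix.mulVec (x.hom a) v + Matrix.mulVec (x.hom b) v
    rw [map_add]
    exact Matrix.add_mulVec _ _ _
  zero_smul v := by
    change Matrix.mulVec (x.hom 0) v = 0
    rw [map_zero]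
    exact Matrix.zero_mulVec v

/-- The action of `GLₙ` on the variety of modules by a change of basis, `(g • x)(a) = g x(a) g⁻¹`.
Its orbits are the isomorphism classes of modules. -/
instance : MulAction (GL (Fin n) k) (ModuleVariety k A n) where
  smul g x := ⟨
    { toFun := fun a => g.1 * x.hom a * (g⁻¹).1
      map_one' := by simp
      map_mul' := fun a b => by simp [mul_assoc]
      map_zero' := by simp
      map_add' := fun a b => by simp [mul_add, add_mul]
      commutes' := fun r => by
        rw [AlgHom.commutes, ← Algebra.commutes, mul_assoc, Units.mul_inv, mul_one] }⟩
  one_smul x := by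
    ext1; ext1 a
    change (1 : GL (Fin n) k).1 * x.hom a * ((1 : GL (Fin n) k)⁻¹).1 = x.hom a
    simp
  mul_smul g h x := by
    ext1; ext1 a
    change (g * h).1 * x.hom a * ((g * h)⁻¹).1 = g.1 * (h.1 * x.hom a * (h⁻¹).1) * (g⁻¹).1
    simp [mul_assoc]

end ModuleVariety

/-- The space `Ext¹(M, M)` of self-extensions of the module `M` which corresponds to a point. -/
abbrev SelfExt (M : ModuleVariety k A n) : Type u :=
  Abelian.Ext (ModuleCat.of A M.Carrier) (ModuleCat.of A M.Carrier) 1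

variable (k n)

/-- The variety `rep(d)` of modules of vector dimension `d`, inside the variety of all
module structures on `kⁿ`. -/
def rep (d : DimVector A) : Set (ModuleVariety k A n) :=
  {x | dimVector A x.Carrier = d}

end Variety

section Rep

variable (k : Type u) (n : ℕ) (A₁ W A₂ : Type u) [Field k] [Ring A₁] [Ring A₂] [AddCommGroup W]
  [Algebra k A₁] [Algebra k A₂] [Module k W] [Module A₁ W] [Module A₂ᵐᵒᵖ W]
  [SMulCommClass A₁ A₂ᵐᵒᵖ W] [IsScalarTower k A₁ W] [IsScalarTower k A₂ᵐᵒᵖ W]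
  (P₁ P₂ : Type u) [AddCommGroup P₁] [Module A₁ P₁] [AddCommGroup P₂] [Module A₂ P₂]

/-- `repᵖ(P₁, P₂)`: the modules `M` over `A₁[W]A₂` such that `e₁M ≃ P₁` and `e₂M ≃ P₂`. -/
def repP : Set (ModuleVariety k (Triangular A₁ W A₂) n) :=
  {x | Nonempty (Part₁ A₁ W A₂ x.Carrier ≃ₗ[A₁] P₁) ∧
    Nonempty (Part₂ A₁ W A₂ x.Carrier ≃ₗ[A₂] P₂)}

/-- `rep(P₁, P₂)`: the closure of `repᵖ(P₁, P₂)` in `rep(d)`, where `d = (dim P₁, dim P₂)`. -/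
def repClosure [Module.Finite k A₁] [Module.Finite k W] [Module.Finite k A₂] :
    Set (ModuleVariety k (Triangular A₁ W A₂) n) :=
  closure (repP k n A₁ W A₂ P₁ P₂) ∩ rep k n (dimVectorPair A₁ W A₂ P₁ P₂)

end Rep

end

end BimoduleReps

/-!
Let `T = A₁[W]A₂` and let `B ⊆ T` be the subalgebra of diagonal matrices. A point `x` lies in
`repᵖ(P₁, P₂)` if and only if its restriction to `B` is isomorphic to that of `M`
(`repP_eq_family`), so that `repᵖ(P₁, P₂)` and the orbit of `M` are two instances of the same
construction: the `family` of those module structures which become equal to `M` on a subspace `B` of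
the algebra after a change of basis, where `B` is the space of diagonal matrices or all of `T`.

The module structures which are equal to `M` on `B` form an affine space `M + V`, where `V` consists
of the derivations `T → End M` which vanish on `B`: such a derivation has values in
`e₁ (End M) e₂`, where all products are zero (`isFiberDirection_diagonal`). Thus a family is the
image of an open subset of `Matₙ × V`, hence irreducible (`isIrreducible_family`). To compute its
dimension, fix a linear projection `π` of `Matₙ` onto the commutant of `B` in `Matₙ`. Near `M`,
a point `x` of the family has a unique intertwiner `g` with `π g = 1`, and `g` is a quotient of
polynomials in `x` by Cramer's rule (`exists_local_section`). Such `x` form an open part of the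
family which is homeomorphic, by rational maps in both directions, to an open subset of an affine
space, and the dimension is `n² - dim (commutant of B) + dim V` (`topologicalKrullDim_family`). The
same local section shows that a family is locally closed
(`exists_isOpen_inter_closure_family_subset`).

Krull dimensions are bounded as follows. A chain of irreducible closed subsets of `Z` is a chain of
prime ideals of the coordinate ring of `Z`, which by Noether normalization is integral over a
polynomial ring in `s` variables. If `Z` lies in the closure of the image of a subset of an affine
space of dimension `N` under a map with rational coordinates, then these variables pull back to
algebraically independent rational functions of `N` variables, so that `s ≤ N`
(`topologicalKrullDim_le_of_regular`). Conversely, flags of affine subspaces give chains in open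
subsets of an affine space (`card_le_topologicalKrullDim`).

On the algebraic side, `Ext¹(M, M)` is the space of derivations `T → End M` modulo the inner ones,
by the long exact sequence of a free presentation of `M` (`exists_derivations_to_selfExt`). The
extension of `M` by itself which belongs to a derivation splits over `B`, because `e₁M ≃ P₁` and
`e₂M ≃ P₂` are projective; so each derivation is inner on `B` (`exists_inner_eq_on_diagonal`).
Counting dimensions then gives
`dim Ext¹(M, M) = dim V + dim End_T M - dim End_B M`
(`finrank_selfExt_add_finrank_commutant`), which is the difference of the dimensions of the two families.

For openness, the orbit is locally closed and `repᵖ(P₁, P₂)` is irreducible, so that the orbit is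
open in `rep(P₁, P₂)` if and only if it is dense there, if and only if the two dimensions agree.
-/

namespace BimoduleReps

noncomputable section

open Topology TopologicalSpace Matrix

attribute [local instance] zariskiTopology

/-! ### Regular functions and the Zariski topology -/

section Regular

variable {k ι κ : Type u} [Field k]

/-- The functions on `X` which are globally quotients `p / q` of polynomials in the coordinates
`c : X → k^ι`, where `q` vanishes nowhere on `X`. -/
def regularFunctions {X : Type*} (c : X → (ι → k)) : Subalgebra k (X → k) where
  carrier := {h | ∃ p q : MvPolynomial ι k, ∀ x, MvPolynomial.eval (c x) q ≠ 0 ∧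
    h x * MvPolynomial.eval (c x) q = MvPolynomial.eval (c x) p}
  mul_mem' := by
    rintro f g ⟨p, q, h⟩ ⟨p', q', h'⟩
    refine ⟨p * p', q * q', fun x => ⟨?_, ?_⟩⟩
    · rw [map_mul]
      exact mul_ne_zero (h x).1 (h' x).1
    · rw [map_mul, map_mul, ← (h x).2, ← (h' x).2, Pi.mul_apply]
      ring
  add_mem' := by
    rintro f g ⟨p, q, h⟩ ⟨p', q', h'⟩
    refine ⟨p * q' + p' * q, q * q', fun x => ⟨?_, ?_⟩⟩
    · rw [map_mul]
      exact mul_ne_zero (h x).1 (h' x).1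
    · rw [map_mul, map_add, map_mul, map_mul, ← (h x).2, ← (h' x).2, Pi.add_apply]
      ring
  algebraMap_mem' r := ⟨MvPolynomial.C r, 1, fun x => by simp⟩

section

variable {X : Type*} {c : X → (ι → k)}

theorem eval_mem_regularFunctions (p : MvPolynomial ι k) :
    (fun x => MvPolynomial.eval (c x) p) ∈ regularFunctions c :=
  ⟨p, 1, fun x => by simp⟩

theorem coord_mem_regularFunctions (i : ι) : (fun x => c x i) ∈ regularFunctions c := by
  simpa using eval_mem_regularFunctions (c := c) (MvPolynomial.X i)

theorem const_mem_regularFunctions (r : k) : (fun _ => r) ∈ regularFunctions c :=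
  (regularFunctions c).algebraMap_mem r

theorem inv_mem_regularFunctions {h : X → k} (hh : h ∈ regularFunctions c) (h0 : ∀ x, h x ≠ 0) :
    (fun x => (h x)⁻¹) ∈ regularFunctions c := by
  obtain ⟨p, q, hpq⟩ := hh
  refine ⟨q, p, fun x => ?_⟩
  have h1 := hpq x
  rw [← h1.2]
  refine ⟨mul_ne_zero (h0 x) h1.1, ?_⟩
  rw [inv_mul_cancel_left₀ (h0 x)]

/-- Regular functions pull back along maps whose coordinates are regular. -/
theorem comp_mem_regularFunctions {Y : Type*} {d : Y → (κ → k)} {φ : Y → X}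
    (hφ : ∀ i, (fun y => c (φ y) i) ∈ regularFunctions d) {h : X → k}
    (hh : h ∈ regularFunctions c) : (fun y => h (φ y)) ∈ regularFunctions d := by
  have key : ∀ p : MvPolynomial ι k,
      (fun y => MvPolynomial.eval (c (φ y)) p) ∈ regularFunctions d := by
    intro p
    induction p using MvPolynomial.induction_on with
    | C a => simpa using const_mem_regularFunctions a
    | add p q hp hq =>
      simp only [map_add]
      exact (regularFunctions d).add_mem hp hq
    | mul_X p i hp =>
      simp only [map_mul, MvPolynomial.eval_X]
      exact (regularFunctions d).mul_mem hp (hφ i)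
  obtain ⟨p, q, hpq⟩ := hh
  have h1 := inv_mem_regularFunctions (key q) fun y => (hpq (φ y)).1
  convert (regularFunctions d).mul_mem (key p) h1 using 1
  ext y
  rw [Pi.mul_apply, ← (hpq (φ y)).2, mul_inv_cancel_right₀ (hpq (φ y)).1]

theorem restrict_mem_regularFunctions {Y : Type*} (φ : Y → X) {h : X → k}
    (hh : h ∈ regularFunctions c) : (fun y => h (φ y)) ∈ regularFunctions (c ∘ φ) :=
  comp_mem_regularFunctions (c := c) (d := c ∘ φ)
    (fun i => coord_mem_regularFunctions (c := c ∘ φ) i) hh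

section Matrix

variable {m : Type*} [Fintype m] {G H : X → Matrix m m k}

theorem mul_apply_mem_regularFunctions
    (hG : ∀ i j, (fun x => G x i j) ∈ regularFunctions c)
    (hH : ∀ i j, (fun x => H x i j) ∈ regularFunctions c) (i j : m) :
    (fun x => (G x * H x) i j) ∈ regularFunctions c := by
  have : (fun x => (G x * H x) i j) = ∑ l, (fun x => G x i l) * fun x => H x l j := by
    ext x
    simp [Matrix.mul_apply]
  rw [this]
  exact Subalgebra.sum_mem _ fun l _ => Subalgebra.mul_mem _ (hG _ _) (hH _ _)

theorem det_mem_regularFunctions [DecidableEq m]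
    (hG : ∀ i j, (fun x => G x i j) ∈ regularFunctions c) :
    (fun x => (G x).det) ∈ regularFunctions c := by
  have : (fun x => (G x).det) =
      ∑ σ : Equiv.Perm m, Equiv.Perm.sign σ • ∏ i, fun x => G x (σ i) i := by
    ext x
    simp [Matrix.det_apply]
  rw [this]
  refine Subalgebra.sum_mem _ fun σ _ => ?_
  rw [Units.smul_def]
  exact zsmul_mem (Subalgebra.prod_mem _ fun i _ => hG _ _) _

theorem inv_apply_mem_regularFunctions [DecidableEq m]
    (hG : ∀ i j, (fun x => G x i j) ∈ regularFunctions c)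
    (h0 : ∀ x, (G x).det ≠ 0) (i j : m) :
    (fun x => (G x)⁻¹ i j) ∈ regularFunctions c := by
  have h1 : (fun x => (G x).adjugate i j) ∈ regularFunctions c := by
    simp only [Matrix.adjugate_apply]
    refine det_mem_regularFunctions fun a b => ?_
    by_cases h : a = j
    · subst h
      simpa using const_mem_regularFunctions _
    · simpa [Matrix.updateRow_ne h] using hG a b
  convert (regularFunctions c).mul_mem
    (inv_mem_regularFunctions (det_mem_regularFunctions hG) h0) h1 using 1
  ext x
  simp [Matrix.inv_def, Ring.inverse_eq_inv']

end Matrix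

end

section Topology

variable {X : Type*} [TopologicalSpace X] {c : X → (ι → k)}

theorem isClosed_affineSp_iff {Z : Set (ι → k)} :
    IsClosed Z ↔ ∃ I : Ideal (MvPolynomial ι k), Z = MvPolynomial.zeroLocus k I := by
  rw [← isOpen_compl_iff]
  change Zᶜᶜ ∈ _ ↔ _
  rw [compl_compl]
  rfl

theorem isClosed_eval_eq_zero (p : MvPolynomial ι k) :
    IsClosed {t : (ι → k) | MvPolynomial.eval t p = 0} := by
  refine isClosed_affineSp_iff.2 ⟨Ideal.span {p}, ?_⟩
  ext t
  simp [MvPolynomial.zeroLocus_span, MvPolynomial.aeval_eq_eval]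

theorem isClosed_zeros (hc : IsInducing c) {h : X → k} (hh : h ∈ regularFunctions c) :
    IsClosed {x | h x = 0} := by
  obtain ⟨p, q, hpq⟩ := hh
  convert (isClosed_eval_eq_zero p).preimage hc.continuous using 1
  ext x
  simp [← (hpq x).2, (hpq x).1]

theorem isOpen_ne_zero (hc : IsInducing c) {h : X → k} (hh : h ∈ regularFunctions c) :
    IsOpen {x | h x ≠ 0} := (isClosed_zeros hc hh).isOpen_compl

/-- A closed set is cut out by polynomials in the coordinates. -/
theorem exists_eval_ne_zero (hc : IsInducing c) {Z : Set X} (hZ : IsClosed Z) {x : X}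
    (hx : x ∉ Z) : ∃ p : MvPolynomial ι k,
      (∀ z ∈ Z, MvPolynomial.eval (c z) p = 0) ∧ MvPolynomial.eval (c x) p ≠ 0 := by
  obtain ⟨T, hT, rfl⟩ := hc.isClosed_iff.1 hZ
  obtain ⟨I, rfl⟩ := isClosed_affineSp_iff.1 hT
  have : ¬ ∀ p ∈ I, MvPolynomial.aeval (R := k) (c x) p = 0 := hx
  push Not at this
  obtain ⟨p, hp, hpx⟩ := this
  exact ⟨p, fun z hz => by simpa [MvPolynomial.aeval_eq_eval] using hz p hp,
    by simpa [MvPolynomial.aeval_eq_eval] using hpx⟩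

/-- Maps with regular coordinates are continuous. -/
theorem continuous_of_regular (hc : IsInducing c) {Y : Type*} [TopologicalSpace Y]
    {d : Y → (κ → k)} (hd : IsInducing d) {φ : X → Y}
    (hφ : ∀ i, (fun x => d (φ x) i) ∈ regularFunctions c) : Continuous φ := by
  rw [hd.continuous_iff, continuous_iff_isClosed]
  intro Z hZ
  obtain ⟨I, rfl⟩ := isClosed_affineSp_iff.1 hZ
  have : (d ∘ φ) ⁻¹' MvPolynomial.zeroLocus k I =
      ⋂ p ∈ I, {x | MvPolynomial.eval (d (φ x)) p = 0} := by
    ext x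
    simp [MvPolynomial.mem_zeroLocus_iff, MvPolynomial.aeval_eq_eval]
  rw [this]
  exact isClosed_biInter fun p _ =>
    isClosed_zeros hc (comp_mem_regularFunctions hφ (eval_mem_regularFunctions p))

instance [Infinite k] : IrreducibleSpace (ι → k) where
  isPreirreducible_univ := by
    rintro u v hu hv ⟨x, -, hx⟩ ⟨y, -, hy⟩
    obtain ⟨p, hp, hpx⟩ := exists_eval_ne_zero (c := (id : (ι → k) → (ι → k)))
      IsInducing.id hu.isClosed_compl (x := x) (by simpa using hx)
    obtain ⟨q, hq, hqy⟩ := exists_eval_ne_zero (c := (id : (ι → k) → (ι → k)))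
      IsInducing.id hv.isClosed_compl (x := y) (by simpa using hy)
    by_contra hcon
    have h0 : p * q = 0 := by
      refine MvPolynomial.funext fun t => ?_
      by_contra ht
      rw [map_zero, map_mul] at ht
      refine hcon ⟨t, trivial, ?_, ?_⟩
      · by_contra htu
        exact ht (by rw [show MvPolynomial.eval t p = 0 from hp t htu, zero_mul])
      · by_contra htv
        exact ht (by rw [show MvPolynomial.eval t q = 0 from hq t htv, mul_zero])
    rcases mul_eq_zero.1 h0 with rfl | rfl
    · simp at hpx
    · simp at hqy
  toNonempty := ⟨fun _ => (0 : k)⟩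

theorem irreducibleSpace_of_isOpenEmbedding [Infinite k] [Nonempty X] (hc : IsOpenEmbedding c) :
    IrreducibleSpace X where
  isPreirreducible_univ := by
    have h := (PreirreducibleSpace.isPreirreducible_univ (X := (ι → k))).preimage hc
    simpa using h
  toNonempty := inferInstance

end Topology

end Regular

/-! ### Dimension bounds -/

section Dimension

variable {k ι κ : Type u} [Field k]

/-- The transcendence degree of the algebra of rational functions without poles on a nonempty set
is at most the number of variables. -/
theorem card_le_of_algebraicIndependent [Fintype κ] {Y : Type*} [Nonempty Y]
    (d : Y → (κ → k)) {s : ℕ} {h : Fin s → Y → k} (hh : ∀ i, h i ∈ regularFunctions d)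
    (hind : AlgebraicIndependent k h) : s ≤ Fintype.card κ := by
  classical
  let ev : MvPolynomial κ k →ₐ[k] (Y → k) :=
    AlgHom.pi fun y => MvPolynomial.aeval (R := k) (d y)
  have ev_apply (p : MvPolynomial κ k) (y : Y) : ev p y = MvPolynomial.eval (d y) p := by
    simp [ev, MvPolynomial.aeval_eq_eval]
  let S : Submonoid (MvPolynomial κ k) := (IsUnit.submonoid (Y → k)).comap ev
  have hS : S ≤ nonZeroDivisors (MvPolynomial κ k) := by
    intro p hp
    rw [mem_nonZeroDivisors_iff_ne_zero]
    rintro rfl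
    have : IsUnit (ev 0) := hp
    rw [map_zero, isUnit_zero_iff] at this
    exact zero_ne_one (congrFun this (Classical.arbitrary Y))
  have hmem (p : MvPolynomial κ k) (hp : ∀ y, MvPolynomial.eval (d y) p ≠ 0) : p ∈ S := by
    change IsUnit (ev p)
    rw [Pi.isUnit_iff]
    intro y
    rw [ev_apply]
    exact (hp y).isUnit
  let ψ : Localization S →ₐ[k] (Y → k) :=
    IsLocalization.liftAlgHom (M := S) (f := ev) fun y => y.2
  choose p q hpq using hh
  let l : Fin s → Localization S := fun i =>
    IsLocalization.mk' _ (p i) ⟨q i, hmem _ fun y => (hpq i y).1⟩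
  have hl : ψ ∘ l = h := by
    ext i y
    have h1 : l i * algebraMap _ _ (q i) = algebraMap _ _ (p i) :=
      IsLocalization.mk'_spec _ _ _
    have h2 := congrFun (congrArg ψ h1) y
    have h3 (r) : ψ (algebraMap _ _ r) = ev r := by
      exact IsLocalization.lift_eq (M := S) _ _
    rw [map_mul, h3, h3, Pi.mul_apply, ev_apply, ev_apply, ← (hpq i y).2] at h2
    exact mul_right_cancel₀ (hpq i y).1 h2
  have hlind : AlgebraicIndependent k l := AlgebraicIndependent.of_comp ψ (hl ▸ hind)
  let j : Localization S →ₐ[k] FractionRing (MvPolynomial κ k) :=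
    IsLocalization.liftAlgHom (M := S)
      (f := IsScalarTower.toAlgHom k (MvPolynomial κ k) (FractionRing (MvPolynomial κ k)))
      fun y => IsLocalization.map_units _ (⟨y, hS y.2⟩ : nonZeroDivisors (MvPolynomial κ k))
  have hj : Function.Injective j := by
    rw [injective_iff_map_eq_zero]
    intro x hx
    obtain ⟨a, b, rfl⟩ := IsLocalization.exists_mk'_eq S x
    have h1 : IsLocalization.mk' (Localization S) a b * algebraMap _ _ (b : MvPolynomial κ k) =
        algebraMap _ _ a := IsLocalization.mk'_spec _ _ _
    have h2 := congrArg j h1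
    rw [map_mul, hx, zero_mul] at h2
    have h3 : j (algebraMap _ _ a) = algebraMap _ (FractionRing (MvPolynomial κ k)) a := by
      exact IsLocalization.lift_eq (M := S) _ _
    rw [h3] at h2
    have h4 : a = 0 := (IsFractionRing.injective (MvPolynomial κ k)
      (FractionRing (MvPolynomial κ k))) (by rw [← h2, map_zero])
    rw [h4, IsLocalization.mk'_zero]
  have h1 := (hlind.map' hj).lift_cardinalMk_le_trdeg
  have : Algebra.IsAlgebraic (MvPolynomial κ k) (FractionRing (MvPolynomial κ k)) :=
    IsLocalization.isAlgebraic _ (nonZeroDivisors (MvPolynomial κ k))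
  have h2 : Algebra.trdeg k (FractionRing (MvPolynomial κ k)) = Cardinal.mk κ := by
    rw [← trdeg_add_eq k (MvPolynomial κ k), MvPolynomial.trdeg_of_isDomain,
      trdeg_eq_zero]
    simp
  rw [h2] at h1
  simpa using h1

variable {X : Type*} [TopologicalSpace X] {c : X → (ι → k)}

/-- A set in the closure of the image of a map with regular coordinates has at most the dimension
of the source. -/
theorem topologicalKrullDim_le_of_regular [Finite ι] [Fintype κ] (hc : IsInducing c)
    {Y : Type*} [Nonempty Y] (d : Y → (κ → k)) {f : Y → X}
    (hf : ∀ i, (fun y => c (f y) i) ∈ regularFunctions d) {Z : Set X}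
    (hZ : Z ⊆ closure (Set.range f)) :
    topologicalKrullDim Z ≤ (Fintype.card κ : ℕ) := by
  rcases isEmpty_or_nonempty Z with hZe | hZe
  · have : IsEmpty (IrreducibleCloseds Z) :=
      ⟨fun C => by obtain ⟨z, -⟩ := C.2.nonempty; exact hZe.elim z⟩
    unfold topologicalKrullDim
    rw [Order.krullDim_eq_bot]
    exact bot_le
  -- the coordinate ring of `Z`, as an algebra of functions
  let res : MvPolynomial ι k →ₐ[k] (Z → k) :=
    AlgHom.pi fun z => MvPolynomial.aeval (R := k) (c z)
  have res_apply (p : MvPolynomial ι k) (z : Z) : res p z = MvPolynomial.eval (c z) p := by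
    simp [res, MvPolynomial.aeval_eq_eval]
  have hft : Algebra.FiniteType k res.range :=
    Algebra.FiniteType.of_surjective res.rangeRestrict res.rangeRestrict_surjective
  obtain ⟨s, g, hg, hgi⟩ := exists_integral_inj_algHom_of_fg k res.range
  have hs : s ≤ Fintype.card κ := by
    choose p hp using fun i => (g (MvPolynomial.X i)).2
    refine card_le_of_algebraicIndependent d
      (h := fun i y => MvPolynomial.eval (c (f y)) (p i))
      (fun i => comp_mem_regularFunctions hf (eval_mem_regularFunctions (p i))) ?_
    rw [algebraicIndependent_iff]
    intro P hP
    have h1 (y : Y) : MvPolynomial.eval (c (f y)) (MvPolynomial.aeval p P) = 0 := by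
      have h2 := congrFun hP y
      rw [Pi.zero_apply] at h2
      rw [← h2, ← MvPolynomial.aeval_eq_eval]
      have h3 (Q : MvPolynomial (Fin s) k) : MvPolynomial.aeval (R := k) (c (f y))
          (MvPolynomial.aeval p Q) =
          MvPolynomial.aeval (fun i y => MvPolynomial.eval (c (f y)) (p i)) Q y := by
        induction Q using MvPolynomial.induction_on with
        | C a => simp
        | add p q hp hq => simp only [map_add, Pi.add_apply, hp, hq]
        | mul_X q i hq => simp only [map_mul, Pi.mul_apply, hq, MvPolynomial.aeval_X,
            MvPolynomial.aeval_eq_eval]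
      exact h3 P
    have h2 : Z ⊆ {x | MvPolynomial.eval (c x) (MvPolynomial.aeval p P) = 0} :=
      hZ.trans (closure_minimal (by rintro _ ⟨y, rfl⟩; exact h1 y)
        (isClosed_zeros hc (eval_mem_regularFunctions _)))
    have h3 : (g P : Z → k) = res (MvPolynomial.aeval p P) := by
      have : (res.range.val.comp g) = res.comp (MvPolynomial.aeval p) := by
        ext1 i
        simpa using (hp i).symm
      exact DFunLike.congr_fun this P
    apply hg
    rw [map_zero]
    ext z
    rw [h3, res_apply]
    simpa using h2 z.2
  -- irreducible closed subsets yield prime ideals of the coordinate ring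
  have hcZ : IsInducing (fun z : Z => c z) := hc.comp IsInducing.subtypeVal
  let J : IrreducibleCloseds Z → Ideal res.range := fun C =>
    { carrier := {b | ∀ z ∈ C, (b : Z → k) z = 0}
      add_mem' := fun ha hb z hz => by simp [ha z hz, hb z hz]
      zero_mem' := fun z _ => rfl
      smul_mem' := fun a b hb z hz => by simp [hb z hz] }
  have hJ (C) : (J C).IsPrime := by
    refine Ideal.isPrime_iff.2 ⟨?_, ?_⟩
    · rw [Ne, Ideal.eq_top_iff_one]
      intro h
      obtain ⟨z, hz⟩ := C.2.nonempty
      exact one_ne_zero (h z hz)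
    · rintro ⟨_, p, rfl⟩ ⟨_, q, rfl⟩ hab
      have hreg (p : MvPolynomial ι k) : IsClosed {z : Z | MvPolynomial.eval (c z) p = 0} :=
        isClosed_zeros hcZ (eval_mem_regularFunctions p)
      have h1 : (C : Set Z) ⊆ {z : Z | MvPolynomial.eval (c z) p = 0} ∪
          {z : Z | MvPolynomial.eval (c z) q = 0} := by
        intro z hz
        have h2 := hab z hz
        have h3 : res p z * res q z = 0 := h2
        rw [res_apply, res_apply] at h3
        exact mul_eq_zero.1 h3
      rcases (isPreirreducible_iff_isClosed_union_isClosed.1 C.2.isPreirreducible) _ _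
        (hreg p) (hreg q) h1 with h | h
      · exact Or.inl fun z hz => (res_apply p z).trans (h hz)
      · exact Or.inr fun z hz => (res_apply q z).trans (h hz)
  have hanti {C C' : IrreducibleCloseds Z} (h : C < C') : J C' < J C := by
    obtain ⟨hle, hne⟩ := Set.ssubset_iff_exists.1
      (show (C : Set Z) ⊂ C' from h)
    obtain ⟨z, hz', hz⟩ := hne
    rw [SetLike.lt_iff_le_and_exists]
    refine ⟨fun b hb z hz => hb z (hle hz), ?_⟩
    obtain ⟨p, hp, hpz⟩ := exists_eval_ne_zero hcZ C.3 (x := z) hz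
    refine ⟨⟨res p, p, rfl⟩, fun z hz => (res_apply p z).trans (hp z hz), fun h => hpz ?_⟩
    rw [← res_apply]
    exact h z hz'
  algebraize [g.toRingHom]
  have hint : Algebra.IsIntegral (MvPolynomial (Fin s) k) res.range := ⟨hgi⟩
  let Φ : IrreducibleCloseds Z → (PrimeSpectrum (MvPolynomial (Fin s) k))ᵒᵈ := fun C =>
    OrderDual.toDual ⟨(J C).comap (algebraMap _ _), (hJ C).comap _⟩
  have hΦ : StrictMono Φ := fun C C' h => by
    have := hJ C'
    exact Ideal.IsIntegral.comap_lt_comap (R := MvPolynomial (Fin s) k) (hanti h)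
  refine (Order.krullDim_le_of_strictMono Φ hΦ).trans ?_
  rw [Order.krullDim_orderDual]
  change ringKrullDim _ ≤ _
  rw [MvPolynomial.ringKrullDim_of_isNoetherianRing, ringKrullDim_eq_zero_of_field]
  simpa using hs

/-- A nonempty open subset of an affine space has at least the dimension of that space. -/
theorem card_le_topologicalKrullDim [Infinite k] [Fintype ι] [Nonempty X]
    (hc : IsOpenEmbedding c) : (Fintype.card ι : ℕ) ≤ topologicalKrullDim X := by
  classical
  obtain ⟨x₀⟩ := ‹Nonempty X›
  let e := Fintype.equivFin ι
  -- the flag of affine subspaces through the point `c x₀`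
  let T : ℕ → Set (ι → k) := fun i => {t | ∀ j, i ≤ (e j : ℕ) → t j = c x₀ j}
  let pr : ℕ → (ι → k) → (ι → k) := fun i t j => if i ≤ (e j : ℕ) then c x₀ j else t j
  have hpr (i : ℕ) : Continuous (pr i) := by
    refine continuous_of_regular (c := id) (d := id) IsInducing.id IsInducing.id fun j => ?_
    by_cases h : i ≤ (e j : ℕ)
    · simpa [pr, h] using const_mem_regularFunctions _
    · simpa [pr, h] using coord_mem_regularFunctions (c := (id : (ι → k) → _)) j
  have hT (i : ℕ) : T i = Set.range (pr i) := by
    ext t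
    constructor
    · intro ht
      refine ⟨t, funext fun j => ?_⟩
      by_cases h : i ≤ (e j : ℕ)
      · simp [pr, h, ht j h]
      · simp [pr, h]
    · rintro ⟨t, rfl⟩ j hj
      simp [pr, hj]
  have hTirr (i : ℕ) : IsIrreducible (T i) := by
    rw [hT, ← Set.image_univ]
    exact (IrreducibleSpace.isIrreducible_univ _).image _ (hpr i).continuousOn
  have hTc (i : ℕ) : IsClosed (T i) := by
    have : T i = ⋂ j, ⋂ (_ : i ≤ (e j : ℕ)), {t | t j - c x₀ j = 0} := by
      ext t
      simp [T, sub_eq_zero]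
    rw [this]
    refine isClosed_iInter fun j => isClosed_iInter fun _ => isClosed_zeros (c := id)
      IsInducing.id ?_
    exact Subalgebra.sub_mem _ (coord_mem_regularFunctions (c := (id : (ι → k) → _)) j)
      (const_mem_regularFunctions _)
  have hmono {i i' : ℕ} (h : i ≤ i') : T i ⊆ T i' := fun t ht j hj => ht j (h.trans hj)
  have hmem (i : ℕ) : c x₀ ∈ T i := fun _ _ => rfl
  let C : Fin (Fintype.card ι + 1) → IrreducibleCloseds X := fun i =>
    ⟨c ⁻¹' T i, ⟨⟨x₀, hmem _⟩, (hTirr i).isPreirreducible.preimage hc⟩,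
      (hTc i).preimage hc.continuous⟩
  have hC : StrictMono C := by
    refine Fin.strictMono_iff_lt_succ.2 fun i => ?_
    refine lt_of_le_of_ne (fun x hx => hmono (Nat.le_succ i) hx) fun heq => ?_
    -- a point of the larger subspace which is not in the smaller one can be found in `X`
    have h1 : (T (i + 1) ∩ (T i)ᶜ).Nonempty := by
      refine ⟨fun j => if e j = i then c x₀ j + 1 else c x₀ j, fun j hj => ?_, fun h => ?_⟩
      · refine if_neg fun h => ?_
        rw [h] at hj
        omega
      · have := h (e.symm i) (by simp)
        simp at this
    obtain ⟨t, ht, ht', x, rfl⟩ := (hTirr (i + 1)).isPreirreducible _ _ (hTc i).isOpen_compl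
      hc.isOpen_range h1 ⟨c x₀, hmem _, x₀, rfl⟩
    have h2 : x ∈ C i.succ := by
      change c x ∈ T i.succ
      simpa using ht
    rw [← heq] at h2
    exact ht' h2
  exact Order.LTSeries.length_le_krullDim (LTSeries.mk (Fintype.card ι) C hC)

end Dimension

/-! ### Families of modules with a prescribed restriction -/

section Families

instance {k E F : Type*} [Field k] [AddCommGroup E] [Module k E] [AddCommGroup F] [Module k F]
    (V : Submodule k (E →ₗ[k] F)) : Module.Free k V :=
  @Module.Free.of_divisionRing k V _ (Submodule.addCommGroup _) _

variable {k A : Type u} [Field k] [Ring A] [Algebra k A] {n : ℕ}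

/-- The matrices which commute with the action on `M` of the elements of a subspace `B` of `A`. -/
def commutant (M : ModuleVariety k A n) (B : Submodule k A) :
    Submodule k (Matrix (Fin n) (Fin n) k) where
  carrier := {g | ∀ b ∈ B, g * M.hom b = M.hom b * g}
  add_mem' hg hh b hb := by rw [add_mul, mul_add, hg b hb, hh b hb]
  zero_mem' b _ := by rw [zero_mul, mul_zero]
  smul_mem' r g hg b hb := by rw [smul_mul_assoc, mul_smul_comm, hg b hb]

/-- The points `x` for which some change of basis makes the action of `B` on `x` equal to its
action on `M`. For `B = ⊤` this is the orbit of `M`; if `B` is a subalgebra, these are the modules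
whose restriction to `B` is isomorphic to that of `M`. -/
def family (M : ModuleVariety k A n) (B : Submodule k A) : Set (ModuleVariety k A n) :=
  {x | ∃ g : GL (Fin n) k, ∀ b ∈ B, (g • x).hom b = M.hom b}

/-- The subspace `V` consists of the differences `x - M`, where `x` runs through the module
structures which agree with `M` on `B`; in particular, these module structures form an affine
space. -/
def IsFiberDirection (M : ModuleVariety k A n) (B : Submodule k A)
    (V : Submodule k (A →ₗ[k] Matrix (Fin n) (Fin n) k)) : Prop :=
  ∀ θ, θ ∈ V ↔ ∃ x : ModuleVariety k A n, (∀ b ∈ B, x.hom b = M.hom b) ∧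
    x.hom.toLinearMap = M.hom.toLinearMap + θ

variable {M : ModuleVariety k A n} {B : Submodule k A}

theorem smul_hom_apply (g : GL (Fin n) k) (x : ModuleVariety k A n) (a : A) :
    (g • x).hom a = g.1 * x.hom a * (g⁻¹).1 := rfl

theorem mem_family_iff {x : ModuleVariety k A n} :
    x ∈ family M B ↔ ∃ g : Matrix (Fin n) (Fin n) k, g.det ≠ 0 ∧
      ∀ b ∈ B, g * x.hom b = M.hom b * g := by
  constructor
  · rintro ⟨g, hg⟩
    refine ⟨g.1, g.det.ne_zero, fun b hb => ?_⟩
    rw [← hg b hb, smul_hom_apply, mul_assoc, Units.inv_mul, mul_one]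
  · rintro ⟨g, h0, hg⟩
    refine ⟨Matrix.GeneralLinearGroup.mkOfDetNeZero g h0, fun b hb => ?_⟩
    rw [smul_hom_apply]
    change g * x.hom b * _ = _
    rw [hg b hb, mul_assoc]
    exact (congrArg (M.hom b * ·)
      (Units.mul_inv (Matrix.GeneralLinearGroup.mkOfDetNeZero g h0))).trans (mul_one _)

theorem mem_family_self : M ∈ family M B := ⟨1, fun b _ => by rw [one_smul]⟩

/-- The family depends only on the restriction of `M` to `B` up to isomorphism. -/
theorem family_eq_of_mem {x : ModuleVariety k A n} (hx : x ∈ family M B) :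
    family x B = family M B := by
  obtain ⟨g, hg⟩ := hx
  have hgx (b) (hb : b ∈ B) : M.hom b = g.1 * x.hom b * (g⁻¹).1 := (hg b hb).symm
  ext y
  constructor
  · rintro ⟨h, hh⟩
    refine ⟨g * h, fun b hb => ?_⟩
    rw [mul_smul, smul_hom_apply, hh b hb, hgx b hb]
  · rintro ⟨h, hh⟩
    refine ⟨g⁻¹ * h, fun b hb => ?_⟩
    rw [mul_smul, smul_hom_apply, hh b hb, hgx b hb]
    simp [mul_assoc]

theorem orbit_eq_family : MulAction.orbit (GL (Fin n) k) M = family M (⊤ : Submodule k A) := by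
  ext x
  rw [MulAction.mem_orbit_symm]
  constructor
  · rintro ⟨g, hg⟩
    exact ⟨g, fun b _ => by rw [← hg]⟩
  · rintro ⟨g, hg⟩
    refine ⟨g, ?_⟩
    ext1
    ext1 a
    exact hg a trivial

variable [Module.Finite k A]

theorem isInducing_coords :
    IsInducing (ModuleVariety.coords : ModuleVariety k A n → _) := ⟨rfl⟩

theorem linear_mem_regularFunctions_of_matrix {X ι : Type u} {c : X → ι → k}
    {G : X → Matrix (Fin n) (Fin n) k}
    (hG : ∀ i j, (fun x => G x i j) ∈ regularFunctions c) (l : Matrix (Fin n) (Fin n) k →ₗ[k] k) :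
    (fun x => l (G x)) ∈ regularFunctions c := by
  have h2 : (fun x => l (G x)) =
      ∑ i, ∑ j, (fun x => G x i j) * fun _ => l (Matrix.single i j (1 : k)) := by
    ext x
    conv_lhs => rw [Matrix.matrix_eq_sum_single (G x)]
    simp only [map_sum, Finset.sum_apply, Pi.mul_apply]
    refine Finset.sum_congr rfl fun i _ => Finset.sum_congr rfl fun j _ => ?_
    rw [← smul_eq_mul, ← map_smul, Matrix.smul_single, smul_eq_mul, mul_one]
  rw [h2]
  exact Subalgebra.sum_mem _ fun i _ => Subalgebra.sum_mem _ fun j _ =>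
    Subalgebra.mul_mem _ (hG i j) (const_mem_regularFunctions _)

theorem linear_mem_regularFunctions_of_hom {X ι : Type u} {c : X → ι → k}
    {θ : X → A →ₗ[k] Matrix (Fin n) (Fin n) k}
    (hθ : ∀ a i j, (fun x => θ x a i j) ∈ regularFunctions c)
    (l : (A →ₗ[k] Matrix (Fin n) (Fin n) k) →ₗ[k] k) :
    (fun x => l (θ x)) ∈ regularFunctions c := by
  let b := Module.finBasis k A
  have h1 (θ : A →ₗ[k] Matrix (Fin n) (Fin n) k) :
      θ = ∑ a, (b.coord a).smulRight (θ (b a)) := by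
    refine b.ext fun a => ?_
    simp [Finsupp.single_apply]
  have h2 : (fun x => l (θ x)) =
      ∑ a, fun x => (l ∘ₗ LinearMap.smulRightₗ (b.coord a)) (θ x (b a)) := by
    ext x
    conv_lhs => rw [h1 (θ x)]
    simp [Finset.sum_apply, LinearMap.smulRightₗ]
  rw [h2]
  exact Subalgebra.sum_mem _ fun a _ => linear_mem_regularFunctions_of_matrix (hθ (b a)) _

theorem hom_apply_mem_regularFunctions (a : A) (i j : Fin n) :
    (fun x : ModuleVariety k A n => x.hom a i j) ∈
      regularFunctions (ModuleVariety.coords (k := k) (A := A) (n := n)) := by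
  let b := Module.finBasis k A
  have : (fun x : ModuleVariety k A n => x.hom a i j) = ∑ l, (fun _ => b.repr a l) *
      fun x : ModuleVariety k A n => x.coords ⟨l, i, j⟩ := by
    ext x
    have h := congrArg (fun a => x.hom a i j) (b.sum_repr a)
    simp only [map_sum, map_smul, Matrix.sum_apply, Matrix.smul_apply, smul_eq_mul] at h
    simp only [Finset.sum_apply, Pi.mul_apply]
    exact h.symm
  rw [this]
  exact Subalgebra.sum_mem _ fun l _ => Subalgebra.mul_mem _ (const_mem_regularFunctions _)
    (coord_mem_regularFunctions _)

theorem linear_hom_mem_regularFunctions (l : (A →ₗ[k] Matrix (Fin n) (Fin n) k) →ₗ[k] k) :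
    (fun x : ModuleVariety k A n => l x.hom.toLinearMap) ∈
      regularFunctions (ModuleVariety.coords (k := k) (A := A) (n := n)) :=
  linear_mem_regularFunctions_of_hom hom_apply_mem_regularFunctions l

section Param

variable {κ : Type u} [Fintype κ]

theorem linear_mem_regularFunctions_pi (l : (κ → k) →ₗ[k] k) :
    (fun t => l t) ∈ regularFunctions (id : (κ → k) → κ → k) := by
  classical
  have : (fun t => l t) = ∑ i, (fun t : κ → k => t i) * fun _ => l (Pi.single i 1) := by
    ext t
    conv_lhs => rw [pi_eq_sum_univ' t]
    simp only [map_sum, map_smul, smul_eq_mul, Finset.sum_apply, Pi.mul_apply]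
  rw [this]
  exact Subalgebra.sum_mem _ fun i _ => Subalgebra.mul_mem _
    (coord_mem_regularFunctions (c := (id : (κ → k) → κ → k)) i) (const_mem_regularFunctions _)

theorem isOpenEmbedding_val_det (γ₀ : Matrix (Fin n) (Fin n) k)
    (γ : (κ → k) →ₗ[k] Matrix (Fin n) (Fin n) k) :
    IsOpenEmbedding (Subtype.val : {t : κ → k // (γ₀ + γ t).det ≠ 0} → κ → k) := by
  refine IsOpen.isOpenEmbedding_subtypeVal (s := {t | (γ₀ + γ t).det ≠ 0})
    (isOpen_ne_zero (c := id) IsInducing.id (det_mem_regularFunctions fun i j => ?_))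
  exact Subalgebra.add_mem _ (const_mem_regularFunctions (γ₀ i j))
    (linear_mem_regularFunctions_pi ((Matrix.entryLinearMap k k i j).comp γ))

/-- The conjugates `g⁻¹ (M + θ) g`, where the matrix `g` and the direction `θ` of the fibre depend
affinely on parameters, depend regularly on these parameters. -/
theorem exists_param {V : Submodule k (A →ₗ[k] Matrix (Fin n) (Fin n) k)}
    (hV : IsFiberDirection M B V) (γ₀ : Matrix (Fin n) (Fin n) k)
    (γ : (κ → k) →ₗ[k] Matrix (Fin n) (Fin n) k)
    (τ : (κ → k) →ₗ[k] (A →ₗ[k] Matrix (Fin n) (Fin n) k)) (hτ : ∀ t, τ t ∈ V) :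
    ∃ f : {t : κ → k // (γ₀ + γ t).det ≠ 0} → ModuleVariety k A n,
      (∀ t a, (γ₀ + γ t.1) * (f t).hom a = (M.hom a + τ t a) * (γ₀ + γ t.1)) ∧
      (∀ t, f t ∈ family M B) ∧
      ∀ i, (fun t => (f t).coords i) ∈
        regularFunctions (Subtype.val : {t : κ → k // (γ₀ + γ t).det ≠ 0} → κ → k) := by
  choose y hyB hy using fun t => (hV (τ t)).1 (hτ t)
  let G (t : {t : κ → k // (γ₀ + γ t).det ≠ 0}) : GL (Fin n) k :=
    Matrix.GeneralLinearGroup.mkOfDetNeZero _ t.2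
  have hG (t) : (G t).1 = γ₀ + γ t.1 := rfl
  have hya (t a) : (y t).hom a = M.hom a + τ t a := DFunLike.congr_fun (hy t) a
  have key (t a) : ((G t)⁻¹ • y t).hom a = (γ₀ + γ t.1)⁻¹ * (M.hom a + τ t a) * (γ₀ + γ t.1) := by
    rw [smul_hom_apply, hya, inv_inv, hG, Matrix.coe_units_inv, hG]
  refine ⟨fun t => (G t)⁻¹ • y t, fun t a => ?_, fun t => ⟨G t, fun b hb => ?_⟩, fun i => ?_⟩
  · rw [key, mul_assoc, Matrix.mul_nonsing_inv_cancel_left _ _ (isUnit_iff_ne_zero.2 t.2)]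
  · rw [smul_inv_smul, hyB t b hb]
  · have hγ (i j) : (fun t : {t : κ → k // (γ₀ + γ t).det ≠ 0} => (γ₀ + γ t.1) i j) ∈
        regularFunctions (Subtype.val : {t : κ → k // (γ₀ + γ t).det ≠ 0} → κ → k) :=
      Subalgebra.add_mem _ (const_mem_regularFunctions (γ₀ i j))
        (restrict_mem_regularFunctions (c := id) Subtype.val
          (linear_mem_regularFunctions_pi ((Matrix.entryLinearMap k k i j).comp γ)))
    simp only [ModuleVariety.coords, key]
    refine mul_apply_mem_regularFunctions (mul_apply_mem_regularFunctions
      (inv_apply_mem_regularFunctions hγ fun t => t.2) fun i' j' => ?_) hγ _ _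
    exact Subalgebra.add_mem _ (const_mem_regularFunctions _)
      (restrict_mem_regularFunctions (c := id) Subtype.val
        (linear_mem_regularFunctions_pi
          ((Matrix.entryLinearMap k k i' j').comp ((LinearMap.applyₗ _).comp τ))))

end Param

theorem isIrreducible_family [Infinite k]
    {V : Submodule k (A →ₗ[k] Matrix (Fin n) (Fin n) k)} (hV : IsFiberDirection M B V) :
    IsIrreducible (family M B) := by
  let κ := ULift.{u} (Fin (Module.finrank k (Matrix (Fin n) (Fin n) k × V)))
  let β : (κ → k) ≃ₗ[k] (Matrix (Fin n) (Fin n) k × V) :=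
    ((Module.finBasis k (Matrix (Fin n) (Fin n) k × V)).reindex Equiv.ulift.symm).equivFun.symm
  obtain ⟨f, hf, hfm, hfr⟩ := exists_param hV 0 ((LinearMap.fst k _ _).comp β.toLinearMap)
    (V.subtype.comp ((LinearMap.snd k _ _).comp β.toLinearMap)) fun t => (β t).2.2
  have hemb := isOpenEmbedding_val_det (0 : Matrix (Fin n) (Fin n) k)
    ((LinearMap.fst k _ _).comp β.toLinearMap)
  have hcont : Continuous f :=
    continuous_of_regular hemb.isInducing isInducing_coords hfr
  have : Nonempty {t : κ → k // (0 + ((LinearMap.fst k _ V).comp β.toLinearMap) t).det ≠ 0} :=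
    ⟨β.symm (1, 0), by simp⟩
  have := irreducibleSpace_of_isOpenEmbedding hemb
  have hrange : family M B = f '' Set.univ := by
    refine subset_antisymm (fun x hx => ?_) (by rintro _ ⟨t, -, rfl⟩; exact hfm t)
    obtain ⟨g, hg⟩ := hx
    have h1 : (g • x).hom.toLinearMap - M.hom.toLinearMap ∈ V :=
      (hV _).2 ⟨g • x, hg, by simp⟩
    refine ⟨⟨β.symm (g.1, ⟨_, h1⟩), ?_⟩, trivial, ?_⟩
    · simpa using g.det.ne_zero
    · ext1
      ext1 a
      have h2 := hf ⟨β.symm (g.1, ⟨_, h1⟩), by simpa using g.det.ne_zero⟩ a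
      simp only [LinearMap.comp_apply, LinearEquiv.coe_coe, LinearEquiv.apply_symm_apply,
        LinearMap.fst_apply, LinearMap.snd_apply, zero_add, Submodule.subtype_apply,
        LinearMap.sub_apply, AlgHom.toLinearMap_apply, add_sub_cancel] at h2
      rw [smul_hom_apply, mul_assoc _ (g⁻¹).1, Units.inv_mul, mul_one] at h2
      exact g.isUnit.mul_left_cancel h2
  rw [hrange]
  exact (IrreducibleSpace.isIrreducible_univ _).image _ hcont.continuousOn

end Families

/-! ### Local sections and the dimension of a family -/

section LocalSection

variable {k A : Type u} [Field k] [Ring A] [Algebra k A] {n : ℕ}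

/-- The linear system for the matrices `g` which intertwine the actions of `B` on `x` and on `M`,
together with the normalization `π g`. -/
def intertwiningSystem (M : ModuleVariety k A n) (B : Submodule k A)
    (π : Matrix (Fin n) (Fin n) k →ₗ[k] Matrix (Fin n) (Fin n) k) (x : ModuleVariety k A n) :
    Matrix (Fin n) (Fin n) k →ₗ[k]
      (B →ₗ[k] Matrix (Fin n) (Fin n) k) × Matrix (Fin n) (Fin n) k where
  toFun g := (LinearMap.mulLeft k g ∘ₗ x.hom.toLinearMap ∘ₗ B.subtype -
    LinearMap.mulRight k g ∘ₗ M.hom.toLinearMap ∘ₗ B.subtype, π g)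
  map_add' g h := by
    ext <;> simp [add_mul, mul_add]
    abel
  map_smul' r g := by
    ext <;> simp [mul_sub]

variable {M : ModuleVariety k A n} {B : Submodule k A}
  {π : Matrix (Fin n) (Fin n) k →ₗ[k] Matrix (Fin n) (Fin n) k}

theorem intertwiningSystem_eq_iff {x : ModuleVariety k A n} {g h : Matrix (Fin n) (Fin n) k} :
    intertwiningSystem M B π x g = (0, h) ↔
      (∀ b ∈ B, g * x.hom b = M.hom b * g) ∧ π g = h := by
  rw [Prod.ext_iff]
  refine and_congr ⟨fun h b hb => ?_, fun h => ?_⟩ Iff.rfl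
  · exact sub_eq_zero.1 (LinearMap.congr_fun h ⟨b, hb⟩)
  · ext1 b
    exact sub_eq_zero.2 (h b b.2)

variable [Module.Finite k A]

/-- Near `M`, the normalized intertwining matrix from `x` to `M` depends regularly on `x`, as the
solution of an overdetermined linear system, and it exists if `x` lies in the family of `M`. -/
theorem exists_local_section (hπ : ∀ g ∈ commutant M B, π g = g)
    (hπ' : ∀ g, π g ∈ commutant M B) :
    ∃ (U : Set (ModuleVariety k A n)) (s : ModuleVariety k A n → Matrix (Fin n) (Fin n) k),
      IsOpen U ∧ M ∈ U ∧ (∀ x ∈ U, (s x).det ≠ 0) ∧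
      (∀ i j, (fun x : U => s x i j) ∈
        regularFunctions (fun x : U => ModuleVariety.coords (x : ModuleVariety k A n))) ∧
      (∀ x ∈ U, ∀ g, (∀ b ∈ B, g * x.hom b = M.hom b * g) → π g = 1 → g = s x) ∧
      ∀ x ∈ U, x ∈ family M B → (∀ b ∈ B, s x * x.hom b = M.hom b * s x) ∧ π (s x) = 1 := by
  classical
  have h1mem : (1 : Matrix (Fin n) (Fin n) k) ∈ commutant M B := fun b _ => by
    rw [one_mul, mul_one]
  have hMinj : LinearMap.ker (intertwiningSystem M B π M) = ⊥ := by
    rw [LinearMap.ker_eq_bot']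
    intro g hg
    obtain ⟨h1, h2⟩ := intertwiningSystem_eq_iff.1 hg
    rw [← hπ g h1, h2]
  obtain ⟨J, hJ⟩ := LinearMap.exists_leftInverse_of_injective _ hMinj
  let b := Matrix.stdBasis k (Fin n) (Fin n)
  let N : ModuleVariety k A n → Matrix (Fin n × Fin n) (Fin n × Fin n) k := fun x =>
    LinearMap.toMatrix b b (J ∘ₗ intertwiningSystem M B π x)
  let w := b.repr (J (0, 1))
  let s : ModuleVariety k A n → Matrix (Fin n) (Fin n) k := fun x => b.equivFun.symm ((N x)⁻¹ *ᵥ w)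
  have hN (i j) : (fun x => N x i j) ∈
      regularFunctions (ModuleVariety.coords (k := k) (A := A) (n := n)) := by
    let l : (A →ₗ[k] Matrix (Fin n) (Fin n) k) →ₗ[k] k :=
      b.coord i ∘ₗ J ∘ₗ LinearMap.inl k _ _ ∘ₗ
        { toFun := fun θ => LinearMap.mulLeft k (b j) ∘ₗ θ ∘ₗ B.subtype
          map_add' := fun θ θ' => by ext1; simp [mul_add]
          map_smul' := fun r θ => by ext1; simp }
    have : (fun x => N x i j) = (fun x => l x.hom.toLinearMap) +
        fun _ => b.coord i (J (-(LinearMap.mulRight k (b j) ∘ₗ M.hom.toLinearMap ∘ₗ B.subtype),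
          π (b j))) := by
      ext x
      simp only [N, LinearMap.toMatrix_apply, Pi.add_apply, l, LinearMap.comp_apply,
        Module.Basis.coord_apply, LinearMap.inl_apply]
      rw [← Finsupp.add_apply, ← map_add, ← map_add, Prod.mk_add_mk, zero_add, ← sub_eq_add_neg]
      rfl
    rw [this]
    exact Subalgebra.add_mem _ (linear_hom_mem_regularFunctions l) (const_mem_regularFunctions _)
  have huniq (x) (hx : (N x).det ≠ 0) (g) (hg : J (intertwiningSystem M B π x g) = J (0, 1)) :
      g = s x := by
    have h1 : N x *ᵥ b.repr g = w := by
      rw [LinearMap.toMatrix_mulVec_repr, LinearMap.comp_apply, hg]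
    have h2 : (b.repr g : Fin n × Fin n → k) = (N x)⁻¹ *ᵥ w := by
      rw [← h1, Matrix.mulVec_mulVec, Matrix.nonsing_inv_mul _ (isUnit_iff_ne_zero.2 hx),
        Matrix.one_mulVec]
    change g = b.equivFun.symm _
    rw [← h2, ← b.equivFun_apply, LinearEquiv.symm_apply_apply]
  let U₀ : Set (ModuleVariety k A n) := {x | (N x).det ≠ 0}
  have hU₀ : IsOpen U₀ := isOpen_ne_zero isInducing_coords (det_mem_regularFunctions hN)
  have hsr (i j) : (fun x : U₀ => s x i j) ∈
      regularFunctions (fun x : U₀ => ModuleVariety.coords (x : ModuleVariety k A n)) := by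
    have : (fun x : U₀ => s x i j) =
        ∑ p, (∑ q, (fun x : U₀ => (N x)⁻¹ p q) * fun _ => w q) * fun _ => b p i j := by
      ext x
      simp [s, Module.Basis.equivFun_symm_apply, Matrix.sum_apply, Matrix.mulVec, dotProduct]
    rw [this]
    refine Subalgebra.sum_mem _ fun p _ => Subalgebra.mul_mem _ (Subalgebra.sum_mem _ fun q _ =>
      Subalgebra.mul_mem _ ?_ (const_mem_regularFunctions _)) (const_mem_regularFunctions _)
    exact inv_apply_mem_regularFunctions
      (fun i j => restrict_mem_regularFunctions (c := ModuleVariety.coords) Subtype.val (hN i j))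
      (fun x => x.2) _ _
  have hMU₀ : M ∈ U₀ := by
    change (LinearMap.toMatrix b b _).det ≠ 0
    rw [hJ, LinearMap.toMatrix_id, Matrix.det_one]
    exact one_ne_zero
  have hM1 : s M = 1 := by
    refine (huniq M hMU₀ 1 (congrArg J (intertwiningSystem_eq_iff.2 ⟨h1mem, hπ _ h1mem⟩))).symm
  let U : Set (ModuleVariety k A n) := Subtype.val '' {x : U₀ | (s x).det ≠ 0}
  have hUU₀ : U ⊆ U₀ := by
    rintro _ ⟨x, -, rfl⟩
    exact x.2
  refine ⟨U, s, ?_, ⟨⟨M, hMU₀⟩, ?_, rfl⟩, ?_, fun i j => ?_, fun x hx g hg hg1 => ?_,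
    fun x hx hxf => ?_⟩
  · exact hU₀.isOpenMap_subtype_val _ (isOpen_ne_zero
      (isInducing_coords.comp IsInducing.subtypeVal) (det_mem_regularFunctions hsr))
  · change (s M).det ≠ 0
    rw [hM1, Matrix.det_one]
    exact one_ne_zero
  · rintro _ ⟨x, hx, rfl⟩
    exact hx
  · exact restrict_mem_regularFunctions (c := fun x : U₀ => ModuleVariety.coords x.1)
      (Set.inclusion hUU₀) (hsr i j)
  · exact huniq x (hUU₀ hx) g (congrArg J (intertwiningSystem_eq_iff.2 ⟨hg, hg1⟩))
  · -- the normalization is an injective endomorphism of the space of intertwining matrices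
    obtain ⟨g₀, h0, hg₀⟩ := mem_family_iff.1 hxf
    let φ : commutant M B →ₗ[k] commutant M B :=
      (π ∘ₗ LinearMap.mulRight k g₀ ∘ₗ (commutant M B).subtype).codRestrict _ fun e => hπ' _
    have hint (e : commutant M B) (b') (hb : b' ∈ B) :
        (e.1 * g₀) * x.hom b' = M.hom b' * (e.1 * g₀) := by
      rw [mul_assoc, hg₀ b' hb, ← mul_assoc, e.2 b' hb, mul_assoc]
    have hNinj (g) (hg : intertwiningSystem M B π x g = 0) : g = 0 := by
      have h1 : N x *ᵥ b.repr g = 0 := by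
        rw [LinearMap.toMatrix_mulVec_repr, LinearMap.comp_apply, hg, map_zero, map_zero]
        rfl
      have h2 := Matrix.eq_zero_of_mulVec_eq_zero (hUU₀ hx) h1
      exact b.repr.map_eq_zero_iff.1 (DFunLike.coe_injective h2)
    have hker (e : commutant M B) (he : φ e = 0) : e.1 * g₀ = 0 :=
      hNinj _ (intertwiningSystem_eq_iff.2 ⟨hint e, congrArg Subtype.val he⟩)
    have hφ : Function.Surjective φ := by
      refine LinearMap.injective_iff_surjective.1 ((injective_iff_map_eq_zero _).2 fun e he => ?_)
      ext1
      have := congrArg (· * g₀⁻¹) (hker e he)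
      simpa [Matrix.mul_nonsing_inv_cancel_right _ _ (isUnit_iff_ne_zero.2 h0)] using this
    obtain ⟨e, he⟩ := hφ ⟨1, h1mem⟩
    have he1 : π (e.1 * g₀) = 1 := congrArg Subtype.val he
    rw [← huniq x (hUU₀ hx) (e.1 * g₀)
      (congrArg J (intertwiningSystem_eq_iff.2 ⟨hint e, he1⟩))]
    exact ⟨hint e, he1⟩

end LocalSection

section FamilyDimension

variable {k A : Type u} [Field k] [Ring A] [Algebra k A] {n : ℕ} {M : ModuleVariety k A n}
  {B : Submodule k A} [Module.Finite k A]

/-- A nonempty relatively open subset of an irreducible set is dense in it. -/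
theorem subset_closure_inter_of_isPreirreducible {X : Type*} [TopologicalSpace X] {S U : Set X}
    (hS : IsPreirreducible S) (hU : IsOpen U) (hSU : (S ∩ U).Nonempty) : S ⊆ closure (S ∩ U) := by
  intro x hx
  rw [mem_closure_iff]
  intro o ho hxo
  obtain ⟨y, hy, hyo, hyU⟩ := hS o U ho hU ⟨x, hx, hxo⟩ hSU
  exact ⟨y, hyo, hy, hyU⟩

/-- A family is locally closed at `M`: being intertwined with `M` on `B` by the local section is a
closed condition. -/
theorem exists_isOpen_inter_closure_family_subset :
    ∃ U : Set (ModuleVariety k A n), IsOpen U ∧ M ∈ U ∧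
      U ∩ closure (family M B) ⊆ family M B := by
  obtain ⟨ρ, hρ⟩ := LinearMap.exists_leftInverse_of_injective _ (commutant M B).ker_subtype
  obtain ⟨U, s, hU, hMU, hdet, hreg, -, hfam⟩ := exists_local_section (M := M) (B := B)
    (π := (commutant M B).subtype ∘ₗ ρ)
    (fun g hg => congrArg Subtype.val (LinearMap.congr_fun hρ ⟨g, hg⟩)) fun g => (ρ g).2
  have hind : IsInducing fun x : U => ModuleVariety.coords (x : ModuleVariety k A n) :=
    isInducing_coords.comp IsInducing.subtypeVal
  refine ⟨U, hU, hMU, ?_⟩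
  let E : Set U := ⋂ b ∈ B, ⋂ i, ⋂ j,
    {x : U | (s x * x.1.hom b) i j - (M.hom b * s x) i j = 0}
  have hE : IsClosed E := by
    refine isClosed_biInter fun b _ => isClosed_iInter fun i => isClosed_iInter fun j =>
      isClosed_zeros hind (Subalgebra.sub_mem _ ?_ ?_)
    · exact mul_apply_mem_regularFunctions hreg (fun i j =>
        restrict_mem_regularFunctions (c := ModuleVariety.coords) Subtype.val
          (hom_apply_mem_regularFunctions b i j)) i j
    · exact mul_apply_mem_regularFunctions (G := fun _ => M.hom b)
        (fun i j => const_mem_regularFunctions _) hreg i j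
  have hEmem (x : U) : x ∈ E ↔ ∀ b ∈ B, s x * x.1.hom b = M.hom b * s x := by
    simp only [E, Set.mem_iInter, Set.mem_ofPred_eq, sub_eq_zero]
    refine forall₂_congr fun b _ => ⟨fun h => ?_, fun h i j => by rw [h]⟩
    ext i j
    exact h i j
  have h1 : U ∩ family M B ⊆ Subtype.val '' E := fun x hx =>
    ⟨⟨x, hx.1⟩, (hEmem _).2 (hfam x hx.1 hx.2).1, rfl⟩
  intro x hx
  have h2 : x ∈ closure (Subtype.val '' E) := closure_mono h1 (hU.inter_closure hx)
  have h3 : (⟨x, hx.1⟩ : U) ∈ E := by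
    rw [← hE.closure_eq]
    exact closure_subtype.2 h2
  exact mem_family_iff.2 ⟨s x, hdet x hx.1, (hEmem _).1 h3⟩

/-- The dimension of a family, and of its closure, is the dimension `n² - c` of the space of
cosets of the commutant plus the dimension of the fibre. -/
theorem topologicalKrullDim_family [Infinite k]
    {V : Submodule k (A →ₗ[k] Matrix (Fin n) (Fin n) k)} (hV : IsFiberDirection M B V) {D : ℕ}
    (hD : D + Module.finrank k (commutant M B) = n * n + Module.finrank k V) :
    (D : WithBot ℕ∞) ≤ topologicalKrullDim (family M B) ∧
      topologicalKrullDim (closure (family M B)) ≤ D := by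
  obtain ⟨ρ, hρ⟩ := LinearMap.exists_leftInverse_of_injective _ (commutant M B).ker_subtype
  have hρ' (e : commutant M B) : ρ e = e := LinearMap.congr_fun hρ e
  obtain ⟨U, s, hU, hMU, hdet, hreg, huniq, hfam⟩ := exists_local_section (M := M) (B := B)
    (π := (commutant M B).subtype ∘ₗ ρ)
    (fun g hg => congrArg Subtype.val (hρ' ⟨g, hg⟩)) fun g => (ρ g).2
  have h1mem : (1 : Matrix (Fin n) (Fin n) k) ∈ commutant M B := fun b _ => by
    rw [one_mul, mul_one]
  have hρ1 : ρ 1 = ⟨1, h1mem⟩ := hρ' ⟨1, h1mem⟩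
  have hfin : Module.finrank k (LinearMap.ker ρ × V) = D := by
    have h1 := LinearMap.finrank_range_add_finrank_ker ρ
    have h2 : LinearMap.range ρ = ⊤ := LinearMap.range_eq_top.2 fun e => ⟨e, hρ' e⟩
    rw [h2, finrank_top, Module.finrank_matrix,
      Module.finrank_self, Fintype.card_fin] at h1
    rw [Module.finrank_prod]
    omega
  let κ := ULift.{u} (Fin D)
  let β : (κ → k) ≃ₗ[k] (LinearMap.ker ρ × V) :=
    ((Module.finBasisOfFinrankEq k _ hfin).reindex Equiv.ulift.symm).equivFun.symm
  have hκ : Fintype.card κ = D := by simp [κ]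
  let γ : (κ → k) →ₗ[k] Matrix (Fin n) (Fin n) k :=
    (LinearMap.ker ρ).subtype ∘ₗ LinearMap.fst k _ _ ∘ₗ β.toLinearMap
  let τ : (κ → k) →ₗ[k] A →ₗ[k] Matrix (Fin n) (Fin n) k :=
    V.subtype ∘ₗ LinearMap.snd k _ _ ∘ₗ β.toLinearMap
  have hγ (t) : ρ (γ t) = 0 := (β t).1.2
  obtain ⟨f, hf, hfm, hfr⟩ := exists_param hV 1 γ τ fun t => (β t).2.2
  have hemb := isOpenEmbedding_val_det 1 γ
  have hf0 : ∃ t : {t : κ → k // (1 + γ t).det ≠ 0}, f t = M := by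
    refine ⟨⟨0, by simp⟩, ?_⟩
    ext1
    ext1 a
    simpa using hf ⟨0, by simp⟩ a
  constructor
  · -- the parametrization is an embedding, since the local section provides a left inverse
    let O := {t // f t ∈ U}
    have hcont : Continuous f := continuous_of_regular hemb.isInducing isInducing_coords hfr
    have hO : IsOpenEmbedding (fun t : O => (t.1.1 : κ → k)) :=
      hemb.comp (IsOpen.isOpenEmbedding_subtypeVal (hU.preimage hcont))
    have : Nonempty O := by
      obtain ⟨t, ht⟩ := hf0
      exact ⟨⟨t, by rw [ht]; exact hMU⟩⟩
    let F : O → U := fun t => ⟨f t, t.2⟩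
    have hF : Continuous F := (hcont.comp continuous_subtype_val).subtype_mk _
    have hind : IsInducing fun x : U => ModuleVariety.coords (x : ModuleVariety k A n) :=
      isInducing_coords.comp IsInducing.subtypeVal
    have hinj : LinearMap.ker (γ.prod τ) = ⊥ := by
      rw [LinearMap.ker_eq_bot']
      intro t ht
      have h1 : β t = 0 := Prod.ext (Subtype.ext (congrArg Prod.fst ht))
        (Subtype.ext (congrArg Prod.snd ht))
      exact β.map_eq_zero_iff.1 h1
    obtain ⟨l, hl⟩ := LinearMap.exists_leftInverse_of_injective _ hinj
    let θ : U → A →ₗ[k] Matrix (Fin n) (Fin n) k := fun x =>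
      LinearMap.mulLeft k (s x) ∘ₗ LinearMap.mulRight k (s x)⁻¹ ∘ₗ x.1.hom.toLinearMap -
        M.hom.toLinearMap
    let R : U → κ → k := fun x => l (s x - 1, θ x)
    have hR : Continuous R := by
      refine continuous_of_regular hind (d := id) IsInducing.id fun i => ?_
      have h1 : (fun x => R x i) =
          (fun x : U => (LinearMap.proj i ∘ₗ l ∘ₗ LinearMap.inl k _ _) (s x - 1)) +
          fun x : U => (LinearMap.proj i ∘ₗ l ∘ₗ LinearMap.inr k _ _) (θ x) := by
        ext x
        simp only [LinearMap.comp_apply, LinearMap.proj_apply, Pi.add_apply, R]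
        rw [← Pi.add_apply (l _) (l _), ← map_add]
        simp
      simp only [id]
      rw [h1]
      refine Subalgebra.add_mem _ (linear_mem_regularFunctions_of_matrix (fun i j =>
        Subalgebra.sub_mem _ (hreg i j) (const_mem_regularFunctions _)) _)
        (linear_mem_regularFunctions_of_hom (fun a i j => Subalgebra.sub_mem _ ?_
          (const_mem_regularFunctions (M.hom a i j))) _)
      exact mul_apply_mem_regularFunctions hreg (mul_apply_mem_regularFunctions
        (fun i j => restrict_mem_regularFunctions (c := ModuleVariety.coords) Subtype.val
          (hom_apply_mem_regularFunctions a i j))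
        (inv_apply_mem_regularFunctions hreg fun x => hdet x x.2)) i j
    have hRF (t : O) : R (F t) = t.1.1 := by
      have hτB (b) (hb : b ∈ B) : τ t.1.1 b = 0 := by
        obtain ⟨y, hy, hy'⟩ := (hV (τ t.1.1)).1 (β t.1.1).2.2
        have h2 := LinearMap.congr_fun hy' b
        simpa [hy b hb] using h2
      have h1 : 1 + γ t.1.1 = s (f t) := by
        refine huniq _ t.2 _ (fun b hb => ?_) ?_
        · rw [hf, hτB b hb, add_zero]
        · simp [hγ, hρ1]
      have h2 : θ (F t) = τ t.1.1 := by
        ext1 a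
        change s (f t) * ((f t).hom a * (s (f t))⁻¹) - M.hom a = _
        rw [← mul_assoc, ← h1, hf,
          Matrix.mul_nonsing_inv_cancel_right _ _ (isUnit_iff_ne_zero.2 t.1.2), add_sub_cancel_left]
      change l (s (f t) - 1, θ (F t)) = _
      rw [h2, ← h1, add_sub_cancel_left]
      exact LinearMap.congr_fun hl t.1.1
    have hFind : IsInducing F := by
      refine IsInducing.of_comp hF hR ?_
      convert hO.isInducing
      exact hRF _
    let G : O → family M B := fun t => ⟨f t, hfm t⟩
    have hFv : IsInducing (fun t : O => f t.1) := IsInducing.subtypeVal.comp hFind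
    have hG : IsInducing G :=
      (IsInducing.subtypeVal (t := family M B)).of_comp_iff.1 hFv
    have := (card_le_topologicalKrullDim hO).trans hG.topologicalKrullDim_le
    rwa [hκ] at this
  · have hsub : family M B ∩ U ⊆ Set.range f := by
      rintro x ⟨hx, hxU⟩
      obtain ⟨hint, h1⟩ := hfam x hxU hx
      let g := Matrix.GeneralLinearGroup.mkOfDetNeZero _ (hdet x hxU)
      have hker : s x - 1 ∈ LinearMap.ker ρ := by
        rw [LinearMap.mem_ker, map_sub, sub_eq_zero, hρ1]
        exact Subtype.ext h1
      have hgs : g.1 = s x := rfl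
      have hgB (b) (hb : b ∈ B) : (g • x).hom b = M.hom b := by
        rw [smul_hom_apply, hgs, hint b hb, ← hgs, mul_assoc, Units.mul_inv, mul_one]
      have hθ : (g • x).hom.toLinearMap - M.hom.toLinearMap ∈ V :=
        (hV _).2 ⟨g • x, hgB, by simp⟩
      let t := β.symm (⟨_, hker⟩, ⟨_, hθ⟩)
      have ht1 : 1 + γ t = s x := by simp [γ, t]
      have ht2 (a) : τ t a = (g • x).hom a - M.hom a := by simp [τ, t]
      have htd : (1 + γ t).det ≠ 0 := by
        rw [ht1]
        exact hdet x hxU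
      refine ⟨⟨t, htd⟩, ?_⟩
      ext1
      ext1 a
      have h2 : (1 + γ t) * (f ⟨t, htd⟩).hom a = (M.hom a + τ t a) * (1 + γ t) := hf ⟨t, htd⟩ a
      generalize f ⟨t, htd⟩ = y at h2 ⊢
      rw [ht1, ht2, add_sub_cancel, smul_hom_apply, ← hgs, mul_assoc _ (g⁻¹).1, Units.inv_mul,
        mul_one] at h2
      exact g.isUnit.mul_left_cancel h2
    have hirr := isIrreducible_family hV
    have hcl : closure (family M B) ⊆ closure (Set.range f) :=
      closure_minimal ((subset_closure_inter_of_isPreirreducible hirr.isPreirreducible hU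
        ⟨M, mem_family_self, hMU⟩).trans (closure_mono hsub)) isClosed_closure
    have : Nonempty {t : κ → k // (1 + γ t).det ≠ 0} := ⟨hf0.choose⟩
    have h := topologicalKrullDim_le_of_regular isInducing_coords
      (Subtype.val : {t : κ → k // (1 + γ t).det ≠ 0} → κ → k) hfr hcl
    rwa [hκ] at h

end FamilyDimension

/-! ### Additivity of Jordan–Hölder multiplicities -/

section JordanHolder

variable {A : Type u} [Ring A]

/-- The number of factors of a series of submodules which are isomorphic to `S`. -/
def stepCount {M : Type u} [AddCommGroup M] [Module A M] (s : CompositionSeries (Submodule A M))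
    (S : Type u) [AddCommGroup S] [Module A S] : ℕ :=
  Nat.card {i : Fin s.length //
    Nonempty ((s i.succ ⧸ (s i.castSucc).submoduleOf (s i.succ)) ≃ₗ[A] S)}

variable {M N Q S : Type u} [AddCommGroup M] [Module A M] [AddCommGroup N] [Module A N]
  [AddCommGroup Q] [Module A Q] [AddCommGroup S] [Module A S]

theorem stepCount_eq_of_equivalent {s t : CompositionSeries (Submodule A M)}
    (h : s.Equivalent t) : stepCount s S = stepCount t S := by
  obtain ⟨f, hf⟩ := h
  refine Nat.card_congr (f.subtypeEquiv fun i => ?_)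
  let e := (hf i).linearEquiv
  exact ⟨fun ⟨φ⟩ => ⟨e.symm.trans φ⟩, fun ⟨φ⟩ => ⟨e.trans φ⟩⟩

theorem jhMultiplicity_eq_stepCount {s : CompositionSeries (Submodule A M)} (h₁ : s.head = ⊥)
    (h₂ : s.last = ⊤) : jhMultiplicity A M S = stepCount s S := by
  have : {m : ℕ | ∃ s : CompositionSeries (Submodule A M), s.head = ⊥ ∧ s.last = ⊤ ∧
      m = stepCount s S} = {stepCount s S} := by
    ext m
    constructor
    · rintro ⟨t, ht₁, ht₂, rfl⟩
      exact stepCount_eq_of_equivalent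
        (CompositionSeries.jordan_holder t s (ht₁.trans h₁.symm) (ht₂.trans h₂.symm))
    · rintro rfl
      exact ⟨s, h₁, h₂, rfl⟩
  change sInf {m : ℕ | ∃ s : CompositionSeries (Submodule A M), s.head = ⊥ ∧ s.last = ⊤ ∧
      m = stepCount s S} = _
  rw [this, csInf_singleton]

theorem stepCount_smash {s t : CompositionSeries (Submodule A M)} (h : s.last = t.head) :
    stepCount (s.smash t h) S = stepCount s S + stepCount t S := by
  unfold stepCount
  rw [← Nat.card_sum]
  refine Nat.card_congr ((((finSumFinEquiv (m := s.length) (n := t.length)).symm.subtypeEquiv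
    (q := Sum.elim
      (fun i => Nonempty ((s i.succ ⧸ (s i.castSucc).submoduleOf (s i.succ)) ≃ₗ[A] S))
      (fun i => Nonempty ((t i.succ ⧸ (t i.castSucc).submoduleOf (t i.succ)) ≃ₗ[A] S)))
    fun i => ?_)).trans (Equiv.subtypeSum (p := Sum.elim _ _)))
  refine Fin.addCases (fun i => ?_) (fun i => ?_) i
  · rw [finSumFinEquiv_symm_apply_castAdd, Sum.elim_inl]
    erw [RelSeries.smash_castAdd, RelSeries.smash_succ_castAdd]
  · rw [finSumFinEquiv_symm_apply_natAdd, Sum.elim_inr]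
    erw [RelSeries.smash_natAdd, RelSeries.smash_succ_natAdd]

/-- Subquotients are preserved by an injective linear map. -/
def quotientMapEquiv {f : N →ₗ[A] M} (hf : Function.Injective f) (p q : Submodule A N) :
    (q ⧸ p.submoduleOf q) ≃ₗ[A] (q.map f ⧸ (p.map f).submoduleOf (q.map f)) :=
  Submodule.Quotient.equiv _ _ (Submodule.equivMapOfInjective f hf q) <| by
    ext ⟨_, y, hy, rfl⟩
    simp only [Submodule.mem_map, Submodule.submoduleOf, Submodule.mem_comap,
      Submodule.subtype_apply]
    constructor
    · rintro ⟨z, hz, hzy⟩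
      exact ⟨z, hz, congrArg Subtype.val hzy⟩
    · rintro ⟨z, hz, hzy⟩
      obtain rfl := hf hzy
      exact ⟨⟨z, hy⟩, hz, rfl⟩

/-- Subquotients are preserved by preimages under a surjective linear map. -/
def quotientComapEquiv {g : M →ₗ[A] Q} (hg : Function.Surjective g) (p q : Submodule A Q) :
    (q.comap g ⧸ (p.comap g).submoduleOf (q.comap g)) ≃ₗ[A] (q ⧸ p.submoduleOf q) :=
  let φ : q.comap g →ₗ[A] q := (g ∘ₗ (q.comap g).subtype).codRestrict q fun x => x.2
  have hφ : Function.Surjective φ := fun ⟨y, hy⟩ => by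
    obtain ⟨x, rfl⟩ := hg y
    exact ⟨⟨x, hy⟩, rfl⟩
  (Submodule.quotEquivOfEq _ _ (by
    rw [LinearMap.ker_comp, Submodule.ker_mkQ]
    rfl)).trans (((p.submoduleOf q).mkQ ∘ₗ φ).quotKerEquivOfSurjective
      ((Submodule.mkQ_surjective _).comp hφ))

/-- Jordan–Hölder multiplicities are additive in short exact sequences. -/
theorem jhMultiplicity_eq_add [IsNoetherian A M] [IsArtinian A M] {f : N →ₗ[A] M} {g : M →ₗ[A] Q}
    (hf : Function.Injective f) (hg : Function.Surjective g)
    (hfg : LinearMap.range f = LinearMap.ker g) :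
    jhMultiplicity A M S = jhMultiplicity A N S + jhMultiplicity A Q S := by
  have := isNoetherian_of_injective f hf
  have := isArtinian_of_injective f hf
  have := isNoetherian_of_surjective g (LinearMap.range_eq_top.2 hg)
  have := isArtinian_of_surjective M g hg
  obtain ⟨s, hs₁, hs₂⟩ := exists_compositionSeries_of_isNoetherian_isArtinian A N
  obtain ⟨t, ht₁, ht₂⟩ := exists_compositionSeries_of_isNoetherian_isArtinian A Q
  let s' : CompositionSeries (Submodule A M) :=
    s.map ⟨Submodule.map f, Submodule.map_covBy_of_injective hf⟩
  let t' : CompositionSeries (Submodule A M) :=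
    t.map ⟨Submodule.comap g, Submodule.comap_covBy_of_surjective hg⟩
  have hst : s'.last = t'.head := by
    change Submodule.map f s.last = Submodule.comap g t.head
    rw [hs₂, ht₁, Submodule.map_top, Submodule.comap_bot, hfg]
  have h₁ : (s'.smash t' hst).head = ⊥ := by
    rw [RelSeries.head_smash]
    change Submodule.map f s.head = ⊥
    rw [hs₁, Submodule.map_bot]
  have h₂ : (s'.smash t' hst).last = ⊤ := by
    rw [RelSeries.last_smash]
    change Submodule.comap g t.last = ⊤
    rw [ht₂, Submodule.comap_top]
  rw [jhMultiplicity_eq_stepCount h₁ h₂, jhMultiplicity_eq_stepCount hs₁ hs₂,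
    jhMultiplicity_eq_stepCount ht₁ ht₂, stepCount_smash]
  congr 1
  · refine Nat.card_congr (Equiv.subtypeEquivRight fun i => ?_)
    let e := quotientMapEquiv hf (s i.castSucc) (s i.succ)
    exact ⟨fun ⟨φ⟩ => ⟨e.trans φ⟩, fun ⟨φ⟩ => ⟨e.symm.trans φ⟩⟩
  · refine Nat.card_congr (Equiv.subtypeEquivRight fun i => ?_)
    let e := quotientComapEquiv hg (t i.castSucc) (t i.succ)
    exact ⟨fun ⟨φ⟩ => ⟨e.symm.trans φ⟩, fun ⟨φ⟩ => ⟨e.trans φ⟩⟩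

end JordanHolder

/-! ### The two parts of a module over a triangular matrix algebra -/

section Parts

variable {A₁ W A₂ : Type u} [Ring A₁] [Ring A₂] [AddCommGroup W]

theorem Triangular.diag₁_one_add_diag₂_one :
    (Triangular.diag₁ 1 + Triangular.diag₂ 1 : Triangular A₁ W A₂) = 1 := by
  ext <;> simp [Triangular.diag₁, Triangular.diag₂]

variable [Module A₁ W] [Module A₂ᵐᵒᵖ W]

theorem Triangular.mul_diag₁_one (a : Triangular A₁ W A₂) :
    a * Triangular.diag₁ 1 = Triangular.diag₁ a.a₁ := by
  ext <;> simp [Triangular.diag₁]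

theorem Triangular.diag₂_one_mul (a : Triangular A₁ W A₂) :
    Triangular.diag₂ 1 * a = Triangular.diag₂ a.a₂ := by
  ext <;> simp [Triangular.diag₂]

theorem Triangular.diag₂_mul_diag₁ (a : A₂) (b : A₁) :
    (Triangular.diag₂ a * Triangular.diag₁ b : Triangular A₁ W A₂) = 0 := by
  ext <;> simp [Triangular.diag₁, Triangular.diag₂]

theorem Triangular.diag₁_mul_diag₂ (a : A₁) (b : A₂) :
    (Triangular.diag₁ a * Triangular.diag₂ b : Triangular A₁ W A₂) = 0 := by
  ext <;> simp [Triangular.diag₁, Triangular.diag₂]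

variable [SMulCommClass A₁ A₂ᵐᵒᵖ W] {M : Type u} [AddCommGroup M] [Module (Triangular A₁ W A₂) M]

variable (A₁ W A₂ M) in
/-- The projection of `M` onto `e₁M`. -/
def toPart₁ : M →+ Part₁ A₁ W A₂ M :=
  (DistribSMul.toAddMonoidHom M (Triangular.diag₁ 1 : Triangular A₁ W A₂)).rangeRestrict

variable (A₁ W A₂ M) in
/-- The projection of `M` onto `e₂M`. -/
def toPart₂ : M →+ Part₂ A₁ W A₂ M :=
  (DistribSMul.toAddMonoidHom M (Triangular.diag₂ 1 : Triangular A₁ W A₂)).rangeRestrict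

@[simp] theorem coe_toPart₁ (m : M) :
    (toPart₁ A₁ W A₂ M m : M) = (Triangular.diag₁ 1 : Triangular A₁ W A₂) • m := rfl

@[simp] theorem coe_toPart₂ (m : M) :
    (toPart₂ A₁ W A₂ M m : M) = (Triangular.diag₂ 1 : Triangular A₁ W A₂) • m := rfl

theorem toPart₁_add_toPart₂ (m : M) : (toPart₁ A₁ W A₂ M m : M) + toPart₂ A₁ W A₂ M m = m := by
  rw [coe_toPart₁, coe_toPart₂, ← add_smul, Triangular.diag₁_one_add_diag₂_one, one_smul]

theorem smul_part₁ (a : Triangular A₁ W A₂) (m : Part₁ A₁ W A₂ M) :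
    a • (m : M) = ((a.a₁ • m : Part₁ A₁ W A₂ M) : M) := by
  rw [part₁_coe_smul, ← Triangular.mul_diag₁_one, mul_smul, diag₁_one_smul]

theorem toPart₂_smul (a : Triangular A₁ W A₂) (m : M) :
    toPart₂ A₁ W A₂ M (a • m) = a.a₂ • toPart₂ A₁ W A₂ M m := by
  ext1
  rw [part₂_coe_smul, coe_toPart₂, coe_toPart₂, ← mul_smul, ← mul_smul, Triangular.diag₂_one_mul,
    ← Triangular.diag₂_mul, mul_one]

/-- The vector dimension of `M` is the sum of those of `e₁M` and `e₂M`, since `e₁M` is a submodule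
with quotient `e₂M`. -/
theorem dimVector_eq_dimVectorPair [IsNoetherian (Triangular A₁ W A₂) M]
    [IsArtinian (Triangular A₁ W A₂) M]
    {P₁ P₂ : Type u} [AddCommGroup P₁] [Module A₁ P₁] [AddCommGroup P₂] [Module A₂ P₂]
    (φ₁ : Part₁ A₁ W A₂ M ≃ₗ[A₁] P₁) (φ₂ : Part₂ A₁ W A₂ M ≃ₗ[A₂] P₂) :
    dimVector (Triangular A₁ W A₂) M = dimVectorPair A₁ W A₂ P₁ P₂ := by
  let _ : Module (Triangular A₁ W A₂) P₁ := Module.compHom P₁ (Triangular.proj₁ A₁ W A₂)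
  let _ : Module (Triangular A₁ W A₂) P₂ := Module.compHom P₂ (Triangular.proj₂ A₁ W A₂)
  let f : P₁ →ₗ[Triangular A₁ W A₂] M :=
    { toFun := fun p => φ₁.symm p
      map_add' := fun p q => by simp
      map_smul' := fun a p => by
        rw [RingHom.id_apply, smul_part₁, ← map_smul]
        rfl }
  let g : M →ₗ[Triangular A₁ W A₂] P₂ :=
    { toFun := fun m => φ₂ (toPart₂ A₁ W A₂ M m)
      map_add' := fun p q => by simp
      map_smul' := fun a p => by
        rw [RingHom.id_apply, toPart₂_smul, map_smul]
        rfl }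
  have hf : Function.Injective f := Subtype.val_injective.comp φ₁.symm.injective
  have hg : Function.Surjective g := φ₂.surjective.comp (AddMonoidHom.rangeRestrict_surjective _)
  have hfg : LinearMap.range f = LinearMap.ker g := by
    ext m
    have h1 : m ∈ LinearMap.ker g ↔ toPart₂ A₁ W A₂ M m = 0 := φ₂.map_eq_zero_iff
    rw [h1]
    constructor
    · rintro ⟨p, rfl⟩
      ext1
      change (Triangular.diag₂ 1 : Triangular A₁ W A₂) • ((φ₁.symm p : Part₁ A₁ W A₂ M) : M) = 0
      rw [← diag₁_one_smul, ← mul_smul, Triangular.diag₂_mul_diag₁, zero_smul]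
    · intro hm
      refine ⟨φ₁ (toPart₁ A₁ W A₂ M m), ?_⟩
      change ((φ₁.symm (φ₁ (toPart₁ A₁ W A₂ M m)) : Part₁ A₁ W A₂ M) : M) = m
      rw [LinearEquiv.symm_apply_apply]
      conv_rhs => rw [← toPart₁_add_toPart₂ (A₁ := A₁) (W := W) (A₂ := A₂) m, hm]
      simp
  funext S
  exact jhMultiplicity_eq_add hf hg hfg

end Parts

/-! ### Self-extensions and derivations -/

section Derivations

variable {k A : Type u} [Field k] [Ring A] [Algebra k A] {n : ℕ}

instance (x : ModuleVariety k A n) : Module k x.Carrier := inferInstanceAs (Module k (Fin n → k))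

instance (x : ModuleVariety k A n) : Module.Finite k x.Carrier :=
  inferInstanceAs (Module.Finite k (Fin n → k))

theorem carrier_smul_def {x : ModuleVariety k A n} (a : A) (v : x.Carrier) :
    a • v = (x.hom a *ᵥ v : Fin n → k) := rfl

instance (x : ModuleVariety k A n) : IsScalarTower k A x.Carrier where
  smul_assoc r a v := by
    rw [carrier_smul_def, carrier_smul_def, map_smul]
    exact Matrix.smul_mulVec _ _ _

/-- The derivations of `A` with values in the bimodule of endomorphisms of `M`. -/
def derivations (M : ModuleVariety k A n) : Submodule k (A →ₗ[k] Matrix (Fin n) (Fin n) k) where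
  carrier := {δ | ∀ a b, δ (a * b) = M.hom a * δ b + δ a * M.hom b}
  add_mem' hδ hε a b := by
    simp only [LinearMap.add_apply, hδ a b, hε a b, mul_add, add_mul]
    abel
  zero_mem' a b := by simp
  smul_mem' r δ hδ a b := by
    simp only [LinearMap.smul_apply, hδ a b, smul_add, mul_smul_comm, smul_mul_assoc]

variable (M : ModuleVariety k A n)

/-- The inner derivation `a ↦ a y - y a` defined by a matrix `y`. -/
def inner : Matrix (Fin n) (Fin n) k →ₗ[k] derivations M where
  toFun y := ⟨LinearMap.mulRight k y ∘ₗ M.hom.toLinearMap -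
    LinearMap.mulLeft k y ∘ₗ M.hom.toLinearMap, fun a b => by
      simp only [LinearMap.sub_apply, LinearMap.comp_apply, AlgHom.toLinearMap_apply, map_mul,
        LinearMap.mulRight_apply, LinearMap.mulLeft_apply]
      noncomm_ring⟩
  map_add' y z := by
    ext1
    ext1 a
    simp [mul_add, add_mul]
    abel
  map_smul' r y := by
    ext1
    ext1 a
    simp [smul_sub]

theorem inner_apply (y : Matrix (Fin n) (Fin n) k) (a : A) :
    (inner M y).1 a = M.hom a * y - y * M.hom a := rfl

theorem ker_inner : LinearMap.ker (inner M) = commutant M ⊤ := by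
  ext y
  rw [LinearMap.mem_ker]
  constructor
  · intro h a _
    have := LinearMap.congr_fun (congrArg Subtype.val h) a
    rw [inner_apply] at this
    exact (sub_eq_zero.1 this).symm
  · intro h
    ext1
    ext1 a
    rw [inner_apply, h a trivial, sub_self]
    rfl

variable {M}

theorem derivations_apply_algebraMap (δ : derivations M) (r : k) :
    δ.1 (algebraMap k A r) = 0 := by
  have h1 : δ.1 1 = 0 := by
    have := δ.2 1 1
    simpa using this
  rw [Algebra.algebraMap_eq_smul_one, map_smul, h1, smul_zero]

variable (M)

/-- Matrices, as endomorphisms of the underlying vector space of `M`. -/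
def act : Matrix (Fin n) (Fin n) k ≃ₗ[k] Module.End k M.Carrier :=
  (Matrix.toLin' : Matrix (Fin n) (Fin n) k ≃ₗ[k] ((Fin n → k) →ₗ[k] (Fin n → k)))

@[simp] theorem act_hom (a : A) (v : M.Carrier) : act M (M.hom a) v = a • v := rfl

theorem act_mul (x y : Matrix (Fin n) (Fin n) k) (v : M.Carrier) :
    act M (x * y) v = act M x (act M y v) :=
  (Matrix.mulVec_mulVec (v : Fin n → k) x y).symm

/-- The standard basis of `kⁿ`, as a basis of the module `M`. -/
def carrierBasis : Module.Basis (Fin n) k M.Carrier := Pi.basisFun k (Fin n)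

/-- The free module `Aⁿ` maps onto `M` by sending the standard basis to that of `kⁿ`. -/
def cover : (Fin n → A) →ₗ[A] M.Carrier := Fintype.linearCombination A (carrierBasis M)

theorem cover_apply (p : Fin n → A) : cover M p = ∑ j, p j • carrierBasis M j := rfl

/-- The `k`-linear section of `cover M` which sends standard basis vectors to each other. -/
def coverSection : M.Carrier →ₗ[k] (Fin n → A) :=
  (LinearMap.pi fun j => Algebra.linearMap k A ∘ₗ LinearMap.proj j) ∘ₗ
    (carrierBasis M).equivFun.toLinearMap

theorem coverSection_apply (v : M.Carrier) (j : Fin n) :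
    coverSection M v j = algebraMap k A ((carrierBasis M).repr v j) := rfl

theorem cover_coverSection (v : M.Carrier) : cover M (coverSection M v) = v := by
  simp only [cover_apply, coverSection_apply, algebraMap_smul]
  exact (carrierBasis M).sum_repr v

theorem cover_surjective : Function.Surjective (cover M) := fun v => ⟨_, cover_coverSection M v⟩

variable {M}

/-- The `k`-linear map `Aⁿ → M` defined by a derivation. -/
def derivationSum : derivations M →ₗ[k] (Fin n → A) →ₗ[k] M.Carrier where
  toFun δ := ∑ j, (LinearMap.applyₗ (carrierBasis M j)) ∘ₗ (act M).toLinearMap ∘ₗ δ.1 ∘ₗ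
    LinearMap.proj j
  map_add' δ ε := by
    ext p
    simp [Finset.sum_add_distrib]
  map_smul' r δ := by
    ext p
    simp [Finset.smul_sum]

theorem derivationSum_apply (δ : derivations M) (p : Fin n → A) :
    derivationSum δ p = ∑ j, act M (δ.1 (p j)) (carrierBasis M j) := by
  simp [derivationSum]

theorem derivationSum_smul (δ : derivations M) (a : A) (p : Fin n → A) :
    derivationSum δ (a • p) = a • derivationSum δ p + act M (δ.1 a) (cover M p) := by
  simp only [derivationSum_apply, cover_apply, map_sum, Finset.smul_sum, Pi.smul_apply,
    smul_eq_mul]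
  rw [← Finset.sum_add_distrib]
  refine Finset.sum_congr rfl fun j _ => ?_
  rw [δ.2, map_add, LinearMap.add_apply, act_mul, act_mul, act_hom, act_hom]

theorem derivationSum_coverSection (δ : derivations M) (v : M.Carrier) :
    derivationSum δ (coverSection M v) = 0 := by
  rw [derivationSum_apply]
  refine Finset.sum_eq_zero fun j _ => ?_
  rw [coverSection_apply, derivations_apply_algebraMap, map_zero, LinearMap.zero_apply]

/-- The restriction of the map defined by a derivation to the kernel of `Aⁿ → M` is `A`-linear. -/
def derivationSyzygy : derivations M →ₗ[k] (LinearMap.ker (cover M) →ₗ[A] M.Carrier) where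
  toFun δ :=
    { toFun := fun p => derivationSum δ p
      map_add' := fun p q => map_add _ _ _
      map_smul' := fun a p => by
        rw [RingHom.id_apply, Submodule.coe_smul, derivationSum_smul, LinearMap.mem_ker.1 p.2,
          map_zero, add_zero] }
  map_add' δ ε := by
    ext p
    simp
  map_smul' r δ := by
    ext p
    simp

theorem derivationSyzygy_apply (δ : derivations M) (p : LinearMap.ker (cover M)) :
    derivationSyzygy δ p = derivationSum δ p := rfl

theorem smul_coverSection_sub_mem (a : A) (v : M.Carrier) :
    a • coverSection M v - coverSection M (a • v) ∈ LinearMap.ker (cover M) := by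
  rw [LinearMap.mem_ker, map_sub, map_smul, cover_coverSection, cover_coverSection, sub_self]

theorem derivationSyzygy_smul_coverSection (δ : derivations M) (a : A) (v : M.Carrier) :
    derivationSyzygy δ ⟨_, smul_coverSection_sub_mem a v⟩ = act M (δ.1 a) v := by
  rw [derivationSyzygy_apply, map_sub, derivationSum_coverSection, derivationSum_smul,
    derivationSum_coverSection, sub_zero, smul_zero, zero_add, cover_coverSection]

theorem derivationSyzygy_injective :
    Function.Injective (derivationSyzygy : derivations M →ₗ[k] _) := by
  rw [injective_iff_map_eq_zero]
  intro δ hδ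
  ext1
  ext1 a
  apply (act M).injective
  ext1 v
  rw [← derivationSyzygy_smul_coverSection, hδ]
  simp

theorem sum_smul_coverSection (p : Fin n → A) :
    ∑ j, p j • coverSection M (carrierBasis M j) = p := by
  ext i
  simp [coverSection_apply, Finsupp.single_apply]

theorem derivationSyzygy_surjective :
    Function.Surjective (derivationSyzygy : derivations M →ₗ[k] _) := by
  intro f
  -- the derivation evaluates `f` on the syzygies between `a • e` and `1 • (a e)`
  let D (a : A) (v : M.Carrier) : M.Carrier := f ⟨_, smul_coverSection_sub_mem a v⟩
  have hDa (a b : A) (v) : D (a + b) v = D a v + D b v := by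
    simp only [D, ← map_add]
    congr 1
    ext1
    simp only [add_smul, map_add, Submodule.coe_add]
    abel
  have hDv (a : A) (v w) : D a (v + w) = D a v + D a w := by
    simp only [D, ← map_add]
    congr 1
    ext1
    simp only [smul_add, map_add, Submodule.coe_add]
    abel
  have hDm (a b : A) (v) : D (a * b) v = a • D b v + D a (b • v) := by
    simp only [D, ← map_add, ← map_smul]
    congr 1
    ext1
    simp only [smul_sub, mul_smul, Submodule.coe_add, Submodule.coe_smul]
    abel
  have hDc (r : k) (v) : D (algebraMap k A r) v = 0 := by
    have : (⟨_, smul_coverSection_sub_mem (algebraMap k A r) v⟩ : LinearMap.ker (cover M)) = 0 := by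
      ext1
      simp only [algebraMap_smul, map_smul, sub_self, Submodule.coe_zero]
    simp only [D, this, map_zero]
  have hDr (r : k) (a : A) (v) : D (r • a) v = r • D a v := by
    rw [Algebra.smul_def, hDm, hDc, add_zero, algebraMap_smul]
  have hDrv (r : k) (a : A) (v) : D a (r • v) = r • D a v := by
    rw [← hDr, Algebra.smul_def, Algebra.commutes, hDm, hDc, smul_zero, zero_add, algebraMap_smul]
  let d : A →ₗ[k] Module.End k M.Carrier :=
    LinearMap.mk₂ k D hDa hDr hDv hDrv
  let δ : derivations M := ⟨(act M).symm.toLinearMap ∘ₗ d, fun a b => by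
    apply (act M).injective
    ext1 v
    simp only [LinearMap.comp_apply, LinearEquiv.coe_coe, LinearEquiv.apply_symm_apply, map_add,
      LinearMap.add_apply, act_mul, act_hom]
    exact hDm a b v⟩
  have hδ (a : A) (v) : act M (δ.1 a) v = D a v := by
    simp only [δ, LinearMap.comp_apply, LinearEquiv.coe_coe, LinearEquiv.apply_symm_apply]
    rfl
  refine ⟨δ, ?_⟩
  ext p
  rw [derivationSyzygy_apply, derivationSum_apply]
  simp only [hδ, D, ← map_sum]
  congr 1
  ext1
  rw [Submodule.coe_sum]
  simp only [Finset.sum_sub_distrib, sum_smul_coverSection]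
  rw [← map_sum, ← cover_apply, LinearMap.mem_ker.1 p.2, map_zero, sub_zero]

/-- A derivation gives a map on the syzygies which extends to the free module if and only if it is
inner. -/
theorem exists_extension_iff (δ : derivations M) :
    (∃ h : (Fin n → A) →ₗ[A] M.Carrier, ∀ p : LinearMap.ker (cover M), h p = derivationSyzygy δ p) ↔
      δ ∈ LinearMap.range (inner M) := by
  have key (y : Matrix (Fin n) (Fin n) k) (p : LinearMap.ker (cover M)) :
      derivationSyzygy (inner M y) p = ∑ j, p.1 j • act M y (carrierBasis M j) := by
    rw [derivationSyzygy_apply, derivationSum_apply]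
    simp only [inner_apply, map_sub, LinearMap.sub_apply, act_mul, act_hom]
    rw [Finset.sum_sub_distrib, ← map_sum, ← cover_apply, LinearMap.mem_ker.1 p.2, map_zero,
      sub_zero]
  constructor
  · rintro ⟨h, hh⟩
    refine ⟨(act M).symm ((carrierBasis M).constr k fun j => h (Pi.single j 1)),
      derivationSyzygy_injective ?_⟩
    ext p
    rw [key, ← hh]
    simp only [LinearEquiv.apply_symm_apply, Module.Basis.constr_basis, ← map_smul]
    rw [← map_sum]
    congr 1
    ext i
    simp [Finset.sum_apply, Pi.single_apply]
  · rintro ⟨y, rfl⟩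
    refine ⟨Fintype.linearCombination A fun j => act M y (carrierBasis M j), fun p => ?_⟩
    rw [key]
    rfl

/-- The short exact sequence which presents `M` as a quotient of the free module `Aⁿ`. -/
abbrev presentation (M : ModuleVariety k A n) : ShortComplex (ModuleCat.{u} A) :=
  ShortComplex.mk (ModuleCat.ofHom (LinearMap.ker (cover M)).subtype)
    (ModuleCat.ofHom (cover M)) (by
      ext p
      exact p.2)

theorem presentation_shortExact : (presentation M).ShortExact where
  exact := by
    rw [ShortComplex.moduleCat_exact_iff]
    intro p hp
    exact ⟨⟨p, hp⟩, rfl⟩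
  mono_f := (ModuleCat.mono_iff_injective _).2 Subtype.val_injective
  epi_g := (ModuleCat.epi_iff_surjective _).2 (cover_surjective M)

/-- The map on the syzygies which is defined by a derivation, as a morphism. -/
def syzygyHom (δ : derivations M) : (presentation M).X₁ ⟶ ModuleCat.of A M.Carrier :=
  ModuleCat.ofHom (derivationSyzygy δ)

theorem syzygyHom_add (δ ε : derivations M) : syzygyHom (δ + ε) = syzygyHom δ + syzygyHom ε :=
  congrArg (ModuleCat.ofHom (X := LinearMap.ker (cover M)) (Y := M.Carrier))
    (map_add derivationSyzygy δ ε)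

theorem syzygyHom_smul_apply (r : k) (δ : derivations M) (p : (presentation M).X₁) :
    (syzygyHom (r • δ)).hom p = algebraMap k A r • (syzygyHom δ).hom p :=
  (LinearMap.congr_fun (map_smul derivationSyzygy r δ) p).trans (algebraMap_smul A r _).symm

/-- `Ext¹(M, M)` is the space of derivations of `A` with values in `End M`, modulo the inner
derivations. -/
theorem exists_derivations_to_selfExt (M : ModuleVariety k A n) :
    ∃ Θ : derivations M →ₗ[k] SelfExt M, Function.Surjective Θ ∧
      LinearMap.ker Θ = LinearMap.range (inner M) := by
  have : Projective (presentation M).X₂ :=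
    ModuleCat.projective_of_free (Pi.basisFun A (Fin n))
  let Θ : derivations M →ₗ[k] SelfExt M :=
    { toFun := fun δ => (presentation_shortExact (M := M)).extClass.comp
        (Abelian.Ext.mk₀ (syzygyHom δ)) (add_zero 1)
      map_add' := fun δ ε => by
        rw [syzygyHom_add, Abelian.Ext.mk₀_add, Abelian.Ext.comp_add]
      map_smul' := fun r δ => by
        rw [RingHom.id_apply, ← Abelian.Ext.comp_smul, ← Abelian.Ext.mk₀_smul]
        congr 2
        ext p
        exact syzygyHom_smul_apply r δ p }
  have hΘ (δ) : Θ δ = (presentation_shortExact (M := M)).extClass.comp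
      (Abelian.Ext.mk₀ (syzygyHom δ)) (add_zero 1) := rfl
  refine ⟨Θ, fun e => ?_, ?_⟩
  · obtain ⟨x, rfl⟩ := Abelian.Ext.contravariant_sequence_exact₃ presentation_shortExact
      (ModuleCat.of A M.Carrier) e (Abelian.Ext.eq_zero_of_projective _) (add_zero 1)
    obtain ⟨f, rfl⟩ := Abelian.Ext.addEquiv₀.symm.surjective x
    obtain ⟨δ, hδ⟩ := derivationSyzygy_surjective f.hom
    have h1 : syzygyHom δ = f := by
      ext p
      exact LinearMap.congr_fun hδ p
    refine ⟨δ, ?_⟩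
    rw [hΘ, h1]
    rfl
  · ext δ
    rw [LinearMap.mem_ker, ← exists_extension_iff, hΘ]
    constructor
    · intro h
      obtain ⟨x, hx⟩ := Abelian.Ext.contravariant_sequence_exact₁ presentation_shortExact
        (ModuleCat.of A M.Carrier) _ (add_zero 1) h
      obtain ⟨f, rfl⟩ := Abelian.Ext.addEquiv₀.symm.surjective x
      refine ⟨f.hom, fun p => ?_⟩
      rw [Abelian.Ext.addEquiv₀_symm_apply, Abelian.Ext.mk₀_comp_mk₀] at hx
      have h1 := (Abelian.Ext.mk₀_bijective _ _).1 hx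
      exact LinearMap.congr_fun (congrArg ModuleCat.Hom.hom h1) p
    · rintro ⟨h, hh⟩
      let h' : (presentation M).X₂ ⟶ ModuleCat.of A M.Carrier := ModuleCat.ofHom h
      have h1 : syzygyHom δ = (presentation M).f ≫ h' := by
        ext p
        exact (hh p).symm
      rw [h1, ← Abelian.Ext.mk₀_comp_mk₀, ShortComplex.ShortExact.extClass_comp_assoc]

end Derivations

/-! ### The codimension of an orbit in a family -/

section Codimension

theorem topologicalKrullDim_mono {X : Type*} [TopologicalSpace X] {S T : Set X} (h : S ⊆ T) :
    topologicalKrullDim S ≤ topologicalKrullDim T :=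
  (IsEmbedding.inclusion h).isInducing.topologicalKrullDim_le

/-- A proper closed subset of an irreducible space of finite dimension `d` has smaller dimension. -/
theorem eq_of_isIrreducible_of_topologicalKrullDim_le {X : Type*} [TopologicalSpace X] {S T : Set X}
    (hST : S ⊆ T) (hS : IsClosed S) (hT : IsIrreducible T) {d : ℕ}
    (h₁ : (d : WithBot ℕ∞) ≤ topologicalKrullDim S) (h₂ : topologicalKrullDim T ≤ d) : S = T := by
  by_contra hne
  have : IrreducibleSpace T := isIrreducible_iff_irreducibleSpace.1 hT
  obtain ⟨p, hp⟩ := Order.le_krullDim_iff.1 h₁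
  let f := Set.inclusion hST
  have hf : IsClosedEmbedding f :=
    IsClosedEmbedding.inclusion hST (hS.preimage continuous_subtype_val)
  have hmono : StrictMono (IrreducibleCloseds.map f hf.continuous) :=
    IrreducibleCloseds.map_strictMono_of_isInducing hf.isEmbedding.isInducing
  let t : IrreducibleCloseds T := ⟨Set.univ, IrreducibleSpace.isIrreducible_univ T, isClosed_univ⟩
  have hlt (s : IrreducibleCloseds S) : IrreducibleCloseds.map f hf.continuous s < t := by
    refine lt_of_le_of_ne (fun x _ => trivial) fun h => hne (hST.antisymm fun x hx => ?_)
    have h1 : closure (f '' (s : Set S)) = Set.univ := congrArg SetLike.coe h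
    rw [(hf.isClosedMap _ s.isClosed).closure_eq] at h1
    obtain ⟨y, -, hy⟩ := h1.ge (Set.mem_univ ⟨x, hx⟩)
    have h2 : y.1 = x := congrArg Subtype.val hy
    exact h2 ▸ y.2
  -- a chain of maximal length in `S` can be extended by `T`
  let q := (p.map _ hmono).snoc t (hlt _)
  have hq : (q.length : WithBot ℕ∞) ≤ topologicalKrullDim T := Order.LTSeries.length_le_krullDim q
  have h3 : q.length = d + 1 := by
    rw [← hp]
    rfl
  rw [h3] at hq
  have := hq.trans h₂
  norm_cast at this
  omega

variable {k A : Type u} [Field k] [Ring A] [Algebra k A] {n : ℕ} {M : ModuleVariety k A n}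
  {B : Submodule k A}

/-- The restriction of derivations to a subspace. -/
def restrictDerivations (M : ModuleVariety k A n) (B : Submodule k A) :
    derivations M →ₗ[k] (B →ₗ[k] Matrix (Fin n) (Fin n) k) :=
  LinearMap.lcomp k _ B.subtype ∘ₗ (derivations M).subtype

/-- The derivations of `A` with values in the bimodule of endomorphisms of `M` which vanish on a
subspace `B`. -/
def relativeDerivations (M : ModuleVariety k A n) (B : Submodule k A) :
    Submodule k (A →ₗ[k] Matrix (Fin n) (Fin n) k) :=
  (LinearMap.ker (restrictDerivations M B)).map (derivations M).subtype

theorem mem_relativeDerivations {θ : A →ₗ[k] Matrix (Fin n) (Fin n) k} :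
    θ ∈ relativeDerivations M B ↔ θ ∈ derivations M ∧ ∀ b ∈ B, θ b = 0 := by
  constructor
  · rintro ⟨δ, hδ, rfl⟩
    exact ⟨δ.2, fun b hb => LinearMap.congr_fun hδ ⟨b, hb⟩⟩
  · rintro ⟨h, h0⟩
    refine ⟨⟨θ, h⟩, ?_, rfl⟩
    ext1 b
    exact h0 b b.2

theorem ker_restrictDerivations_comp_inner :
    LinearMap.ker (restrictDerivations M B ∘ₗ inner M) = commutant M B := by
  ext y
  rw [LinearMap.mem_ker]
  constructor
  · intro h b hb
    have h1 := LinearMap.congr_fun h ⟨b, hb⟩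
    exact (sub_eq_zero.1 h1).symm
  · intro h
    ext1 b
    exact sub_eq_zero.2 (h b b.2).symm

theorem isFiberDirection_top : IsFiberDirection M (⊤ : Submodule k A) ⊥ := by
  intro θ
  rw [Submodule.mem_bot]
  constructor
  · rintro rfl
    exact ⟨M, fun _ _ => rfl, (add_zero _).symm⟩
  · rintro ⟨x, hx, hθ⟩
    ext1 a
    have := LinearMap.congr_fun hθ a
    simpa [hx a trivial] using this

variable [Module.Finite k A]

instance : Module.Finite k (SelfExt M) :=
  have ⟨Θ, hΘ, _⟩ := exists_derivations_to_selfExt M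
  Module.Finite.of_surjective Θ hΘ

/-- If all derivations are inner on `B`, then the self-extensions of `M` come from the derivations
which vanish on `B`. -/
theorem finrank_selfExt_add_finrank_commutant
    (hB : ∀ δ : derivations M, ∃ y, ∀ b ∈ B, δ.1 b = (inner M y).1 b) :
    Module.finrank k (SelfExt M) + Module.finrank k (commutant M B) =
      Module.finrank k (relativeDerivations M B) +
        Module.finrank k (commutant M (⊤ : Submodule k A)) := by
  obtain ⟨Θ, hΘ, hker⟩ := exists_derivations_to_selfExt M
  have h1 := LinearMap.finrank_range_add_finrank_ker (K := k) (V := derivations M)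
    (V₂ := SelfExt M) Θ
  have h2 := LinearMap.finrank_range_add_finrank_ker (K := k)
    (V := Matrix (Fin n) (Fin n) k) (V₂ := derivations M) (inner M)
  have h3 := LinearMap.finrank_range_add_finrank_ker (K := k) (V := derivations M)
    (V₂ := B →ₗ[k] Matrix (Fin n) (Fin n) k) (restrictDerivations M B)
  have h4 := LinearMap.finrank_range_add_finrank_ker (K := k)
    (V := Matrix (Fin n) (Fin n) k) (V₂ := B →ₗ[k] Matrix (Fin n) (Fin n) k)
    (restrictDerivations M B ∘ₗ inner M)
  have h5 : LinearMap.range (restrictDerivations M B) =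
      LinearMap.range (restrictDerivations M B ∘ₗ inner M) := by
    refine le_antisymm ?_ (LinearMap.range_comp_le_range _ _)
    rintro _ ⟨δ, rfl⟩
    obtain ⟨y, hy⟩ := hB δ
    refine ⟨y, ?_⟩
    ext1 b
    exact (hy b b.2).symm
  have h6 : Module.finrank k (relativeDerivations M B) =
      Module.finrank k (LinearMap.ker (restrictDerivations M B)) :=
    Submodule.finrank_map_subtype_eq _ _
  rw [LinearMap.range_eq_top.2 hΘ, finrank_top, hker] at h1
  rw [ker_inner] at h2
  rw [ker_restrictDerivations_comp_inner, ← h5] at h4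
  omega

/-- Suppose that the module structures which agree with `M` on `B` are the sums of `M` and a
derivation vanishing on `B`, and that all derivations are inner on `B`. Then the codimension of the
orbit of `M` in the family of modules which are isomorphic to `M` on `B` is the dimension of
`Ext¹(M, M)`. -/
theorem codim_orbit_of_isFiberDirection [Infinite k]
    (hV : IsFiberDirection M B (relativeDerivations M B))
    (hB : ∀ δ : derivations M, ∃ y, ∀ b ∈ B, δ.1 b = (inner M y).1 b)
    {Y : Set (ModuleVariety k A n)} (hY : family M B ⊆ Y) (hY' : Y ⊆ closure (family M B)) :
    MulAction.orbit (GL (Fin n) k) M ⊆ Y ∧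
    (∃ d : ℕ, topologicalKrullDim (MulAction.orbit (GL (Fin n) k) M) = d ∧
      topologicalKrullDim Y =
        ((d + Module.finrank k (SelfExt M) : ℕ) : WithBot ℕ∞)) ∧
    (IsOpen ((↑) ⁻¹' MulAction.orbit (GL (Fin n) k) M : Set Y) ↔ Subsingleton (SelfExt M)) := by
  rw [orbit_eq_family]
  have hOF : family M ⊤ ⊆ family M B := fun x ⟨g, hg⟩ => ⟨g, fun b _ => hg b trivial⟩
  have hn : Module.finrank k (commutant M (⊤ : Submodule k A)) ≤ n * n := by
    simpa [Module.finrank_matrix] using Submodule.finrank_le (commutant M (⊤ : Submodule k A))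
  obtain ⟨d, hd⟩ := Nat.exists_eq_add_of_le hn
  obtain ⟨hO1, hO2⟩ := topologicalKrullDim_family (isFiberDirection_top (M := M)) (D := d) (by
    rw [finrank_bot]
    omega)
  have hext := finrank_selfExt_add_finrank_commutant hB
  obtain ⟨hF1, hF2⟩ := topologicalKrullDim_family hV (D := d + Module.finrank k (SelfExt M)) (by
    omega)
  refine ⟨hOF.trans hY, ⟨d, le_antisymm ((topologicalKrullDim_mono subset_closure).trans hO2) hO1,
    le_antisymm ((topologicalKrullDim_mono hY').trans hF2)
      (hF1.trans (topologicalKrullDim_mono hY))⟩, ?_⟩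
  rw [← Module.finrank_zero_iff (R := k)]
  constructor
  · rintro ⟨U, hU, hUO⟩
    have hmem (x) (hx : x ∈ Y) : x ∈ U ↔ x ∈ family M ⊤ := Set.ext_iff.1 hUO ⟨x, hx⟩
    have h1 := subset_closure_inter_of_isPreirreducible (isIrreducible_family hV).isPreirreducible
      hU ⟨M, mem_family_self, (hmem M (hY mem_family_self)).2 mem_family_self⟩
    have h2 : family M B ⊆ closure (family M ⊤) :=
      h1.trans (closure_mono fun x hx => (hmem x (hY hx.1)).1 hx.2)
    have h3 := (hF1.trans (topologicalKrullDim_mono h2)).trans hO2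
    norm_cast at h3
    omega
  · intro h0
    rw [h0, add_zero] at hF2
    have hcl := eq_of_isIrreducible_of_topologicalKrullDim_le (closure_mono hOF) isClosed_closure
      (isIrreducible_family hV).closure (hO1.trans (topologicalKrullDim_mono subset_closure)) hF2
    rw [isOpen_iff_forall_mem_open]
    intro x hx
    obtain ⟨U, hU, hxU, hUO⟩ := exists_isOpen_inter_closure_family_subset (M := x.1)
      (B := (⊤ : Submodule k A))
    rw [family_eq_of_mem hx, hcl] at hUO
    exact ⟨Subtype.val ⁻¹' U, fun y hy => hUO ⟨hy, hY' y.2⟩,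
      hU.preimage continuous_subtype_val, hxU⟩

end Codimension

/-! ### Maps which commute with the diagonal matrices -/

section Glue

variable {A₁ W A₂ : Type u} [Ring A₁] [Ring A₂] [AddCommGroup W] [Module A₁ W] [Module A₂ᵐᵒᵖ W]
  [SMulCommClass A₁ A₂ᵐᵒᵖ W] {X Y : Type u} [AddCommGroup X] [Module (Triangular A₁ W A₂) X]
  [AddCommGroup Y] [Module (Triangular A₁ W A₂) Y]

theorem toPart₁_smul {b : Triangular A₁ W A₂} (hb : b.w = 0) (m : X) :
    toPart₁ A₁ W A₂ X (b • m) = b.a₁ • toPart₁ A₁ W A₂ X m := by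
  ext1
  rw [part₁_coe_smul, coe_toPart₁, coe_toPart₁, ← mul_smul, ← mul_smul]
  congr 1
  ext <;> simp [Triangular.diag₁, hb]

theorem smul_part₂ {b : Triangular A₁ W A₂} (hb : b.w = 0) (m : Part₂ A₁ W A₂ X) :
    b • (m : X) = ((b.a₂ • m : Part₂ A₁ W A₂ X) : X) := by
  rw [part₂_coe_smul, ← diag₂_one_smul m, ← mul_smul, ← mul_smul]
  congr 1
  ext <;> simp [Triangular.diag₂, hb]

theorem toPart₁_coe_part₁ (m : Part₁ A₁ W A₂ X) : toPart₁ A₁ W A₂ X m = m :=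
  Subtype.ext (diag₁_one_smul m)

theorem toPart₂_coe_part₂ (m : Part₂ A₁ W A₂ X) : toPart₂ A₁ W A₂ X m = m :=
  Subtype.ext (diag₂_one_smul m)

theorem toPart₁_coe_part₂ (m : Part₂ A₁ W A₂ X) : toPart₁ A₁ W A₂ X m = 0 := by
  ext1
  rw [coe_toPart₁, ← diag₂_one_smul m, ← mul_smul, Triangular.diag₁_mul_diag₂, zero_smul]
  rfl

theorem toPart₂_coe_part₁ (m : Part₁ A₁ W A₂ X) : toPart₂ A₁ W A₂ X m = 0 := by
  ext1
  rw [coe_toPart₂, ← diag₁_one_smul m, ← mul_smul, Triangular.diag₂_mul_diag₁, zero_smul]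
  rfl

/-- The map between modules over a triangular matrix algebra which is given by maps between their
parts. -/
def glue (σ₁ : Part₁ A₁ W A₂ X →ₗ[A₁] Part₁ A₁ W A₂ Y)
    (σ₂ : Part₂ A₁ W A₂ X →ₗ[A₂] Part₂ A₁ W A₂ Y) : X →+ Y :=
  (Part₁ A₁ W A₂ Y).subtype.comp (σ₁.toAddMonoidHom.comp (toPart₁ A₁ W A₂ X)) +
    (Part₂ A₁ W A₂ Y).subtype.comp (σ₂.toAddMonoidHom.comp (toPart₂ A₁ W A₂ X))

variable {σ₁ : Part₁ A₁ W A₂ X →ₗ[A₁] Part₁ A₁ W A₂ Y}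
  {σ₂ : Part₂ A₁ W A₂ X →ₗ[A₂] Part₂ A₁ W A₂ Y}

theorem glue_apply (m : X) :
    glue σ₁ σ₂ m = σ₁ (toPart₁ A₁ W A₂ X m) + σ₂ (toPart₂ A₁ W A₂ X m) := rfl

theorem glue_smul {b : Triangular A₁ W A₂} (hb : b.w = 0) (m : X) :
    glue σ₁ σ₂ (b • m) = b • glue σ₁ σ₂ m := by
  rw [glue_apply, glue_apply, smul_add, smul_part₁, smul_part₂ hb, toPart₁_smul hb, toPart₂_smul,
    map_smul, map_smul]

theorem glue_injective (h₁ : Function.Injective σ₁) (h₂ : Function.Injective σ₂) :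
    Function.Injective (glue σ₁ σ₂) := by
  rw [injective_iff_map_eq_zero]
  intro m hm
  rw [glue_apply] at hm
  have e₁ := congrArg (toPart₁ A₁ W A₂ Y) hm
  have e₂ := congrArg (toPart₂ A₁ W A₂ Y) hm
  rw [map_add, toPart₁_coe_part₁, toPart₁_coe_part₂, add_zero, map_zero,
    map_eq_zero_iff σ₁ h₁] at e₁
  rw [map_add, toPart₂_coe_part₂, toPart₂_coe_part₁, zero_add, map_zero,
    map_eq_zero_iff σ₂ h₂] at e₂
  rw [← toPart₁_add_toPart₂ (A₁ := A₁) (W := W) (A₂ := A₂) m, e₁, e₂]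
  simp

/-- The map `e₁X → e₁Y` which is induced by a map commuting with the diagonal matrices. -/
def partMap₁ (f : X →+ Y) (hf : ∀ b : Triangular A₁ W A₂, b.w = 0 → ∀ m, f (b • m) = b • f m) :
    Part₁ A₁ W A₂ X →ₗ[A₁] Part₁ A₁ W A₂ Y where
  toFun m := ⟨f m, f m, by
    conv_rhs => rw [← diag₁_one_smul m]
    exact (hf _ rfl _).symm⟩
  map_add' m m' := Subtype.ext (map_add f _ _)
  map_smul' a m := Subtype.ext (hf _ rfl _)

/-- The map `e₂X → e₂Y` which is induced by a map commuting with the diagonal matrices. -/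
def partMap₂ (f : X →+ Y) (hf : ∀ b : Triangular A₁ W A₂, b.w = 0 → ∀ m, f (b • m) = b • f m) :
    Part₂ A₁ W A₂ X →ₗ[A₂] Part₂ A₁ W A₂ Y where
  toFun m := ⟨f m, f m, by
    conv_rhs => rw [← diag₂_one_smul m]
    exact (hf _ rfl _).symm⟩
  map_add' m m' := Subtype.ext (map_add f _ _)
  map_smul' a m := Subtype.ext (hf _ rfl _)

variable {f : X →+ Y} (hf : ∀ b : Triangular A₁ W A₂, b.w = 0 → ∀ m, f (b • m) = b • f m)

theorem partMap₁_injective (h : Function.Injective f) : Function.Injective (partMap₁ f hf) :=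
  fun _ _ hxy => Subtype.ext (h (congrArg Subtype.val hxy))

theorem partMap₂_injective (h : Function.Injective f) : Function.Injective (partMap₂ f hf) :=
  fun _ _ hxy => Subtype.ext (h (congrArg Subtype.val hxy))

theorem partMap₁_surjective (h : Function.Surjective f) : Function.Surjective (partMap₁ f hf) := by
  intro y
  obtain ⟨x, hx⟩ := h y
  refine ⟨toPart₁ A₁ W A₂ X x, Subtype.ext ?_⟩
  exact (hf _ rfl _).trans ((congrArg _ hx).trans (diag₁_one_smul y))

theorem partMap₂_surjective (h : Function.Surjective f) : Function.Surjective (partMap₂ f hf) := by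
  intro y
  obtain ⟨x, hx⟩ := h y
  refine ⟨toPart₂ A₁ W A₂ X x, Subtype.ext ?_⟩
  exact (hf _ rfl _).trans ((congrArg _ hx).trans (diag₂_one_smul y))

end Glue

/-! ### The extension defined by a derivation -/

section Twist

variable {k A : Type u} [Field k] [Ring A] [Algebra k A] {n : ℕ} {M : ModuleVariety k A n}

/-- The extension of `M` by itself which is defined by a derivation `δ`: an element `a` acts on
`M × M` by the block matrix with rows `(a, δ a)` and `(0, a)`. -/
def TwistedSum (_δ : derivations M) : Type u := M.Carrier × M.Carrier

variable (δ : derivations M)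

instance : AddCommGroup (TwistedSum δ) := inferInstanceAs (AddCommGroup (M.Carrier × M.Carrier))

instance : Module A (TwistedSum δ) where
  smul a v := (a • v.1 + act M (δ.1 a) v.2, a • v.2)
  one_smul v := by
    change (((1 : A) • v.1 + act M (δ.1 1) v.2, (1 : A) • v.2) : M.Carrier × M.Carrier) = v
    rw [← map_one (algebraMap k A), derivations_apply_algebraMap]
    simp only [map_one, one_smul, map_zero, LinearMap.zero_apply, add_zero]
    rfl
  mul_smul a b v := by
    change (((a * b) • v.1 + act M (δ.1 (a * b)) v.2, (a * b) • v.2) : M.Carrier × M.Carrier) =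
      (a • (b • v.1 + act M (δ.1 b) v.2) + act M (δ.1 a) (b • v.2), a • b • v.2)
    rw [δ.2, map_add, LinearMap.add_apply, act_mul, act_mul, act_hom, act_hom, mul_smul, mul_smul,
      smul_add, add_assoc]
  smul_zero a := by
    change ((a • 0 + act M (δ.1 a) 0, a • 0) : M.Carrier × M.Carrier) = 0
    simp
  smul_add a v w := by
    change ((a • (v.1 + w.1) + act M (δ.1 a) (v.2 + w.2), a • (v.2 + w.2)) :
      M.Carrier × M.Carrier) = (a • v.1 + act M (δ.1 a) v.2 + (a • w.1 + act M (δ.1 a) w.2),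
        a • v.2 + a • w.2)
    rw [smul_add, smul_add, map_add, add_add_add_comm]
  add_smul a b v := by
    change (((a + b) • v.1 + act M (δ.1 (a + b)) v.2, (a + b) • v.2) : M.Carrier × M.Carrier) =
      (a • v.1 + act M (δ.1 a) v.2 + (b • v.1 + act M (δ.1 b) v.2), a • v.2 + b • v.2)
    rw [add_smul, add_smul, map_add, map_add, LinearMap.add_apply, add_add_add_comm]
  zero_smul v := by
    change (((0 : A) • v.1 + act M (δ.1 0) v.2, (0 : A) • v.2) : M.Carrier × M.Carrier) = 0
    simp

/-- The projection of the extension defined by a derivation onto its quotient `M`. -/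
def TwistedSum.snd : TwistedSum δ →+ M.Carrier := AddMonoidHom.snd M.Carrier M.Carrier

/-- The projection of the extension defined by a derivation onto the first summand, which is not a
homomorphism of modules. -/
def TwistedSum.fst : TwistedSum δ →+ M.Carrier := AddMonoidHom.fst M.Carrier M.Carrier

variable {δ}

theorem TwistedSum.snd_smul (a : A) (v : TwistedSum δ) : snd δ (a • v) = a • snd δ v := rfl

theorem TwistedSum.fst_smul (a : A) (v : TwistedSum δ) :
    fst δ (a • v) = a • fst δ v + act M (δ.1 a) (snd δ v) := rfl

theorem TwistedSum.snd_surjective : Function.Surjective (snd δ) := fun v => ⟨(0, v), rfl⟩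

end Twist

/-! ### Modules over triangular matrix algebras with prescribed parts -/

section TriangularFamilies

variable {k A₁ W A₂ : Type u} [Field k] [Ring A₁] [Ring A₂] [AddCommGroup W] [Algebra k A₁]
  [Algebra k A₂] [Module k W] [Module A₁ W] [Module A₂ᵐᵒᵖ W] [SMulCommClass A₁ A₂ᵐᵒᵖ W]
  [IsScalarTower k A₁ W] [IsScalarTower k A₂ᵐᵒᵖ W] {n : ℕ}

variable (k A₁ W A₂) in
/-- The subspace of diagonal matrices. -/
def diagonal : Submodule k (Triangular A₁ W A₂) where
  carrier := {b | b.w = 0}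
  add_mem' ha hb := (congrArg₂ (· + ·) ha hb).trans (add_zero 0)
  zero_mem' := rfl
  smul_mem' r _ ha := (congrArg (r • ·) ha).trans (smul_zero r)

theorem algebraMap_mem_diagonal (r : k) :
    algebraMap k (Triangular A₁ W A₂) r ∈ diagonal k A₁ W A₂ := by
  rw [Algebra.algebraMap_eq_smul_one]
  exact Submodule.smul_mem _ _ rfl

variable {M : ModuleVariety k (Triangular A₁ W A₂) n}

/-- A map which commutes with the diagonal matrices, among them the scalars, as a `k`-linear map. -/
def linearMapOfDiagonal {x : ModuleVariety k (Triangular A₁ W A₂) n} (f : x.Carrier →+ M.Carrier)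
    (hf : ∀ b : Triangular A₁ W A₂, b.w = 0 → ∀ m, f (b • m) = b • f m) :
    (Fin n → k) →ₗ[k] (Fin n → k) where
  toFun v := f v
  map_add' v w := map_add f v w
  map_smul' r v := by
    have h (v : x.Carrier) : f (r • v) = r • f v := by
      have h := hf _ (algebraMap_mem_diagonal (k := k) r) v
      rwa [algebraMap_smul, algebraMap_smul] at h
    exact h v

theorem mul_eq_mul_iff_mulVec (g x y : Matrix (Fin n) (Fin n) k) :
    g * x = y * g ↔ ∀ v, g *ᵥ (x *ᵥ v) = y *ᵥ (g *ᵥ v) := by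
  simp only [Matrix.mulVec_mulVec]
  exact ⟨fun h v => by rw [h], fun h => Matrix.toLin'.injective (LinearMap.ext h)⟩

variable {P₁ P₂ : Type u} [AddCommGroup P₁] [Module A₁ P₁] [AddCommGroup P₂] [Module A₂ P₂]

/-- Two modules have isomorphic parts if and only if their restrictions to the diagonal matrices are
isomorphic. -/
theorem repP_eq_family (hM : M ∈ repP k n A₁ W A₂ P₁ P₂) :
    repP k n A₁ W A₂ P₁ P₂ = family M (diagonal k A₁ W A₂) := by
  obtain ⟨⟨φ₁⟩, ⟨φ₂⟩⟩ := hM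
  ext x
  rw [mem_family_iff]
  constructor
  · rintro ⟨⟨ψ₁⟩, ⟨ψ₂⟩⟩
    let f := glue (ψ₁.trans φ₁.symm).toLinearMap (ψ₂.trans φ₂.symm).toLinearMap
    have hf (b : Triangular A₁ W A₂) (hb : b.w = 0) (m) : f (b • m) = b • f m := glue_smul hb m
    have hinj : Function.Injective f :=
      glue_injective (ψ₁.trans φ₁.symm).injective (ψ₂.trans φ₂.symm).injective
    let g := LinearMap.toMatrix' (linearMapOfDiagonal f hf)
    have hg (v : Fin n → k) : g *ᵥ v = f v := LinearMap.toMatrix'_mulVec _ _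
    refine ⟨g, ?_, fun b hb => ?_⟩
    · rw [← isUnit_iff_ne_zero, ← Matrix.isUnit_iff_isUnit_det,
        ← Matrix.mulVec_injective_iff_isUnit]
      intro v w hvw
      rw [hg, hg] at hvw
      exact hinj hvw
    · rw [mul_eq_mul_iff_mulVec]
      intro v
      rw [hg, hg]
      exact hf b hb v
  · rintro ⟨g, hg0, hg⟩
    let f : x.Carrier →+ M.Carrier := g.mulVecLin.toAddMonoidHom
    have hf (b : Triangular A₁ W A₂) (hb : b.w = 0) (m) : f (b • m) = b • f m :=
      (mul_eq_mul_iff_mulVec _ _ _).1 (hg b hb) m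
    have hu : IsUnit g := (Matrix.isUnit_iff_isUnit_det g).2 (isUnit_iff_ne_zero.2 hg0)
    have hinj : Function.Injective f := Matrix.mulVec_injective_iff_isUnit.2 hu
    have hsurj : Function.Surjective f := Matrix.mulVec_surjective_iff_isUnit.2 hu
    exact ⟨⟨(LinearEquiv.ofBijective _
        ⟨partMap₁_injective hf hinj, partMap₁_surjective hf hsurj⟩).trans φ₁⟩,
      ⟨(LinearEquiv.ofBijective _
        ⟨partMap₂_injective hf hinj, partMap₂_surjective hf hsurj⟩).trans φ₂⟩⟩

theorem repP_subset_rep [Module.Finite k A₁] [Module.Finite k W] [Module.Finite k A₂] :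
    repP k n A₁ W A₂ P₁ P₂ ⊆ rep k n (dimVectorPair A₁ W A₂ P₁ P₂) := by
  rintro x ⟨⟨ψ₁⟩, ⟨ψ₂⟩⟩
  have : IsNoetherian (Triangular A₁ W A₂) x.Carrier := isNoetherian_of_tower k inferInstance
  have : IsArtinian (Triangular A₁ W A₂) x.Carrier := isArtinian_of_tower k inferInstance
  exact dimVector_eq_dimVectorPair ψ₁ ψ₂

/-- If `e₁M` and `e₂M` are projective, then the extension of `M` defined by a derivation splits over
the diagonal matrices, so that the derivation is inner there. -/
theorem exists_inner_eq_on_diagonal [Module.Projective A₁ P₁] [Module.Projective A₂ P₂]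
    (hM : M ∈ repP k n A₁ W A₂ P₁ P₂) (δ : derivations M) :
    ∃ y, ∀ b ∈ diagonal k A₁ W A₂, δ.1 b = (inner M y).1 b := by
  obtain ⟨⟨φ₁⟩, ⟨φ₂⟩⟩ := hM
  have := Module.Projective.of_equiv φ₁.symm
  have := Module.Projective.of_equiv φ₂.symm
  have hf (b : Triangular A₁ W A₂) (_ : b.w = 0) (m : TwistedSum δ) :
      TwistedSum.snd δ (b • m) = b • TwistedSum.snd δ m := TwistedSum.snd_smul b m
  obtain ⟨σ₁, h₁⟩ := Module.projective_lifting_property (partMap₁ _ hf) LinearMap.id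
    (partMap₁_surjective hf TwistedSum.snd_surjective)
  obtain ⟨σ₂, h₂⟩ := Module.projective_lifting_property (partMap₂ _ hf) LinearMap.id
    (partMap₂_surjective hf TwistedSum.snd_surjective)
  have hsnd (m : M.Carrier) : TwistedSum.snd δ (glue σ₁ σ₂ m) = m := by
    rw [glue_apply, map_add]
    conv_rhs => rw [← toPart₁_add_toPart₂ (A₁ := A₁) (W := W) (A₂ := A₂) m]
    exact congrArg₂ (· + ·) (congrArg Subtype.val (LinearMap.congr_fun h₁ _))
      (congrArg Subtype.val (LinearMap.congr_fun h₂ _))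
  -- the section over the diagonal matrices has the form `m ↦ (f m, m)`
  let f : M.Carrier →+ M.Carrier := (TwistedSum.fst δ).comp (glue σ₁ σ₂)
  have hfb (b : Triangular A₁ W A₂) (hb : b.w = 0) (m) :
      f (b • m) = b • f m + act M (δ.1 b) m := by
    change TwistedSum.fst δ (glue σ₁ σ₂ (b • m)) = _
    rw [glue_smul hb, TwistedSum.fst_smul, hsnd]
    rfl
  let f' : Module.End k M.Carrier :=
    { toFun := f
      map_add' := map_add f
      map_smul' := fun r v => by
        have h := hfb _ (algebraMap_mem_diagonal (k := k) r) v
        rwa [derivations_apply_algebraMap, map_zero, LinearMap.zero_apply, add_zero,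
          algebraMap_smul, algebraMap_smul] at h }
  refine ⟨-(act M).symm f', fun b hb => ?_⟩
  apply (act M).injective
  ext1 v
  have h : f' (b • v) = b • f' v + act M (δ.1 b) v := hfb b hb v
  rw [inner_apply, mul_neg, neg_mul, sub_neg_eq_add, neg_add_eq_sub, map_sub, LinearMap.sub_apply,
    act_mul, act_mul, act_hom, act_hom, LinearEquiv.apply_symm_apply, h, add_sub_cancel_left]

/-- A linear map which vanishes on the diagonal matrices and commutes with the idempotents `e₁` and
`e₂` is concentrated in the upper right corner, so that its values have trivial products. -/
theorem apply_mul_apply_eq_zero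
    {θ : Triangular A₁ W A₂ →ₗ[k] Matrix (Fin n) (Fin n) k}
    (h0 : ∀ b ∈ diagonal k A₁ W A₂, θ b = 0)
    (hθ : ∀ a, θ (Triangular.diag₁ 1 * a * Triangular.diag₂ 1) =
      M.hom (Triangular.diag₁ 1) * θ a * M.hom (Triangular.diag₂ 1)) (a b : Triangular A₁ W A₂) :
    θ a * θ b = 0 := by
  have key (a) : θ a = M.hom (Triangular.diag₁ 1) * θ a * M.hom (Triangular.diag₂ 1) := by
    rw [← hθ, ← sub_eq_zero, ← map_sub]
    refine h0 _ ?_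
    change (a - _).w = 0
    rw [sub_eq_add_neg]
    simp [Triangular.diag₁, Triangular.diag₂]
  rw [key a, key b]
  calc _ = M.hom (Triangular.diag₁ 1) * θ a * (M.hom (Triangular.diag₂ 1) *
        M.hom (Triangular.diag₁ 1)) * θ b * M.hom (Triangular.diag₂ 1) := by noncomm_ring
    _ = 0 := by
      rw [← map_mul, Triangular.diag₂_mul_diag₁, map_zero]
      simp

/-- The module structures which agree with `M` on the diagonal matrices form an affine space. -/
theorem isFiberDirection_diagonal :
    IsFiberDirection M (diagonal k A₁ W A₂) (relativeDerivations M (diagonal k A₁ W A₂)) := by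
  have he₁ : (Triangular.diag₁ 1 : Triangular A₁ W A₂) ∈ diagonal k A₁ W A₂ := rfl
  have he₂ : (Triangular.diag₂ 1 : Triangular A₁ W A₂) ∈ diagonal k A₁ W A₂ := rfl
  intro θ
  rw [mem_relativeDerivations]
  constructor
  · rintro ⟨hθ, h0⟩
    have hmul := apply_mul_apply_eq_zero (M := M) h0 fun a => by
      rw [hθ, h0 _ he₂, mul_zero, zero_add, hθ, h0 _ he₁, zero_mul, add_zero]
    refine ⟨⟨AlgHom.ofLinearMap (M.hom.toLinearMap + θ) ?_ fun a b => ?_⟩, fun b hb => ?_, ?_⟩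
    · rw [LinearMap.add_apply, AlgHom.toLinearMap_apply, map_one, h0 1 rfl, add_zero]
    · simp only [LinearMap.add_apply, AlgHom.toLinearMap_apply, map_mul, hθ a b, mul_add, add_mul,
        hmul]
      abel
    · simp [h0 b hb]
    · ext1 a
      rfl
  · rintro ⟨x, hx, hxθ⟩
    have hθ (a) : θ a = x.hom a - M.hom a := by
      rw [eq_sub_iff_add_eq']
      exact (LinearMap.congr_fun hxθ a).symm
    have h0 (b) (hb : b ∈ diagonal k A₁ W A₂) : θ b = 0 := by rw [hθ, hx b hb, sub_self]
    have hmul := apply_mul_apply_eq_zero (M := M) h0 fun a => by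
      simp only [hθ, map_mul, hx _ he₁, hx _ he₂, mul_sub, sub_mul]
    refine ⟨fun a b => ?_, h0⟩
    have hxa (a) : x.hom a = M.hom a + θ a := by rw [hθ, add_sub_cancel]
    rw [hθ (a * b), map_mul, map_mul, hxa, hxa, mul_add, add_mul, add_mul, hmul]
    abel

end TriangularFamilies

end

end BimoduleReps

open BimoduleReps in
theorem corollary3p2 (k : Type u) [Field k] [IsAlgClosed k]
    -- finite dimensional algebras and a finite dimensional `k`-central bimodule
    (A₁ A₂ W : Type u) [Ring A₁] [Ring A₂] [AddCommGroup W] [Algebra k A₁] [Algebra k A₂]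
    [Module k W] [Module A₁ W] [Module A₂ᵐᵒᵖ W] [SMulCommClass A₁ A₂ᵐᵒᵖ W]
    [IsScalarTower k A₁ W] [IsScalarTower k A₂ᵐᵒᵖ W]
    [Module.Finite k A₁] [Module.Finite k A₂] [Module.Finite k W]
    -- `W` is projective as a left module
    [Module.Projective A₁ W]
    -- finitely generated projective modules
    (P₁ P₂ : Type u) [AddCommGroup P₁] [Module A₁ P₁] [AddCommGroup P₂] [Module A₂ P₂]
    [Module.Finite A₁ P₁] [Module.Projective A₁ P₁]
    [Module.Finite A₂ P₂] [Module.Projective A₂ P₂]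
    (n : ℕ) (M : ModuleVariety k (Triangular A₁ W A₂) n)
    (hM : M ∈ repP k n A₁ W A₂ P₁ P₂) :
    -- the orbit lies in `rep(P₁, P₂)`, and `Ext¹(M, M)` is finite dimensional
    MulAction.orbit (GL (Fin n) k) M ⊆ repClosure k n A₁ W A₂ P₁ P₂ ∧
    Module.Finite k (SelfExt M) ∧
    -- the codimension of the orbit in `rep(P₁, P₂)` is `dim Ext¹(M, M)`
    (∃ d : ℕ, topologicalKrullDim (MulAction.orbit (GL (Fin n) k) M) = d ∧
      topologicalKrullDim (repClosure k n A₁ W A₂ P₁ P₂) =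
        ((d + Module.finrank k (SelfExt M) : ℕ) : WithBot ℕ∞)) ∧
    -- the orbit is open in `rep(P₁, P₂)` if and only if `Ext¹(M, M) = 0`
    (IsOpen ((↑) ⁻¹' MulAction.orbit (GL (Fin n) k) M : Set (repClosure k n A₁ W A₂ P₁ P₂)) ↔
      Subsingleton (SelfExt M)) := by
  obtain ⟨h₁, h₂, h₃⟩ := codim_orbit_of_isFiberDirection isFiberDirection_diagonal
    (exists_inner_eq_on_diagonal hM) (Y := repClosure k n A₁ W A₂ P₁ P₂)
    (by
      rw [← repP_eq_family hM]
      exact fun x hx => ⟨subset_closure hx, repP_subset_rep hx⟩)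
    (by
      rw [← repP_eq_family hM]
      exact Set.inter_subset_left)
  exact ⟨h₁, inferInstance, h₂, h₃⟩
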